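/- **Setting.** Let $x_{t+1}=f(x_t,u_t,w_t)$ with $f:\mathbb R^n\times\mathbb R^m\times\mathbb R^g\to\mathbb R^n$, with noise $\|w_t\|\le w_{\max}$ ($w_{\max}>0$), initial state $x_0\ne0$, controllers $\pi_1,\dots,\pi_N:\mathbb R^n\to\mathbb R^m$ and costs $c_t:\mathbb R^n\times\mathbb R^m\to[0,\infty)$. The sequences $(w_t)$, $(c_t)$ are arbitrary but do not depend on the algorithm's random choices. Assume that $f$ is $L_f$-Lipschitz for $\|w\|\le w_{\max}$ (that is, $\|f(x,u,w)-f(\tilde x,\tilde u,\tilde w)\|\le L_f(\|x-\tilde x\|+\|u-\tilde u\|+\|w-\tilde w\|)$, $L_f\ge1$), $\|f(0,0,0)\|\le f_0$, every $\pi_i$ is $L_\pi$-Lipschitz with $\|\pi_i(0)\|\le\pi_{0,\max}$, $|c_t(0,0)|\le c_{0,\max}$, and $$|c_t(x,u)-c_t(\tilde x,\tilde u)|\le\bigl(L_{c1}(\max\{\|x\|,\|\tilde x\|\}+\max\{\|u\|,\|\tilde u\|\})+L_{c2}\bigr)(\|x-\tilde x\|+\|u-\tilde u\|).$$ Fix a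 non-increasing $\beta:\mathbb Z_+\to\mathbb R$ with $\beta(0)=1$, $\beta(t)\to0$, and $\gamma>0$; put $H(t)=\sum_{i=0}^{t-1}\beta(i)$. A controller $\pi$ is input-to-state stable (ISS) if every closed-loop trajectory $x_{t+1}=f(x_t,\pi(x_t),w_t)$ with $\|w_t\|\le w_{\max}$ satisfies $\|x_t\|\le\beta(t)\|x_0\|+\gamma w_{\max}$, and incrementally stable if any two such trajectories with the same noise satisfy $\|x_t-\tilde x_t\|\le\beta(t)\|x_0-\tilde x_0\|$. Let $\mathcal U$ be the set of controllers that are not ISS and $\mathcal S$ the set of those that are ISS and incrementally stable; assume $\mathcal S\neq\emptyset$. **Algorithm (DBAR).** Inputs: $T$, $\eta_0>0$, batch lengths $(\tau_b)$, $\beta,\gamma$, $\alpha_0>1$, $\delta\ge\gamma w_{\max}/(1-\beta(\tau_0))$. Start with $t_0=s_0=0$, $W_0=0$, $\mathcal P_0=\{1,\dots,N\}$, $p_0$ uniform. In batch $b$ draw $K_b\sim p_b$ and apply $\pi_{K_b}$ at times $t=t_b,\dots,\min(t_b+\tau_b-1,T)$, but if $\|x_{t+1}\|>\beta(t+1-t_b)\|x_{t_b}\|+\gamma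 w_{\max}$ is observed, remove $K_b$ from the pool ($\mathcal P_{b+1}=\mathcal P_b\setminus\{K_b\}$; otherwise $\mathcal P_{b+1}=\mathcal P_b$) and end the batch; let $t_{b+1}=t+1$ for the last $t$ used. If $\|x_{t_{b+1}}\|<\alpha_b\|x_0\|+\delta$, put $(\alpha_{b+1},s_{b+1})=(\alpha_b,0)$. Otherwise let $s\ge1$ satisfy $\alpha_b^s\|x_0\|\le\|x_{t_{b+1}}\|-\delta<\alpha_b^{s+1}\|x_0\|$; if $s\le s_b+1$ put $(\alpha_{b+1},s_{b+1})=(\alpha_b,s)$; if $s>s_b+1$ put $s_{b+1}=s_b+1$ and let $\alpha_{b+1}$ be any $\alpha>\alpha_b$ with $\alpha^{s_b+1}\|x_0\|\le\|x_{t_{b+1}}\|-\delta<\alpha^{s_b+2}\|x_0\|$. Let $w_b=\sum_{t=t_b}^{t_{b+1}-1}c_t(x_t,u_t)$ and $w_b'(k)=\frac{w_b}{p_b(k)}\mathbf 1_{K_b=k}$; put $W_{b+1}=0$ if $s_{b+1}\ne s_b$ and $W_{b+1}=W_b+w_b'$ otherwise; $\eta_{b+1}=\eta_0/\alpha_{b+1}^{2s_{b+1}}$;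 and $p_{b+1}(k)\propto\exp(-\eta_{b+1}W_{b+1}(k))$ on $\mathcal P_{b+1}$. Stop when time $T$ has been processed (or the pool is empty). The regret is $\mathrm{Regret}_T=\mathbb E\sum_{t=0}^T[c_t(x_t,u_t)-c_t(x_t^*,u_t^*)]$, where $\mathbb E$ is over the $K_b$ and $(x_t^*,u_t^*)$ is the trajectory, from the same $x_0$ and with the same noise, of a controller in $\mathcal S$ with least total cost over $t=0,\dots,T$. **Theorem.** Put $M=N(|\mathcal U|+1)$. Let $\tau_0=\lfloor(z/M)^{1/2}\rfloor$ and $\tau_b=\lceil((\nu b+z)/M)^{1/2}\rceil$ for $b\ge1$, with $z,\nu>0$ such that $\tau_0>0$ and $\frac{\tau_1}{\tau_0}\beta(\tau_0)^2<\frac1{2\sqrt2}$. Let $a_1\frac{(|\mathcal U|+1)^{2/3}}{T^{2/3}N^{1/3}}\le\eta_0\le a_2\frac{(|\mathcal U|+1)^{2/3}}{T^{2/3}N^{1/3}}$ with constants $0<a_1\le a_2$, and let $T\ge\max\{|\mathcal U|^{3/2}M^{-1/2},\,M\}$. Then $$\mathrm{Regret}_T\le\tilde O\bigl(T^{2/3}N^{1/3}(|\mathcal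 U|+1)^{1/3}\bigr)+o(1)\exp(O(|\mathcal U|))+o(1)\,T,$$ where each $o(1)$ tends to $0$ as $T/M\to\infty$; in particular, for fixed $N$ and $|\mathcal U|$ the regret is sublinear: for every $\varepsilon>0$, $\mathrm{Regret}_T\le\varepsilon T$ for all large $T$. If moreover $H(t)\le O(\sum_{i=1}^t\frac1i)$ for all $t\ge1$, then $$\mathrm{Regret}_T\le\bigl[\tilde O(T^{2/3})+\tilde O(T^{-1/3})\exp(O(|\mathcal U|))\bigr]N^{1/3}(|\mathcal U|+1)^{1/3}.$$ Here $\tilde O$ hides a fixed power of $1+\log T$. The implied constants and rates depend only on $L_f,f_0,L_{c1},L_{c2},c_{0,\max},L_\pi,\pi_{0,\max},w_{\max},\|x_0\|,\beta,\gamma,\alpha_0,\delta,\nu,a_1,a_2$ and an upper bound for $z/M$; in particular not on $T$, $N$, $|\mathcal U|$, the dimensions, the noise or the cost sequence. -/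

import Mathlib

open Filter Topology
open scoped BigOperators

noncomputable section

namespace DBAR

/-- `ℝⁿ` with the Euclidean norm. -/
abbrev Vec (n : ℕ) : Type := EuclideanSpace ℝ (Fin n)

/-! ### Closed-loop trajectories and controller stability -/

/-- Trajectory of `x_{t+1} = f (x_t, π (x_t), w_t)` started at `x`. -/
def closedLoop {n m g : ℕ} (f : Vec n → Vec m → Vec g → Vec n) (π : Vec n → Vec m)
    (w : ℕ → Vec g) (x : Vec n) : ℕ → Vec n
  | 0 => x
  | t + 1 => f (closedLoop f π w x t) (π (closedLoop f π w x t)) (w t)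

/-- Admissible decay profile `β : ℤ₊ → ℝ`: non-increasing, `β 0 = 1`, `β t → 0`. -/
structure IsDecay (β : ℕ → ℝ) : Prop where
  antitone : Antitone β
  zero : β 0 = 1
  tendsto : Tendsto β atTop (𝓝 0)

/-- `π` is input-to-state stable with decay `β` and gain `γ`. -/
def IsISS {n m g : ℕ} (f : Vec n → Vec m → Vec g → Vec n) (wmax : ℝ) (β : ℕ → ℝ) (γ : ℝ)
    (π : Vec n → Vec m) : Prop :=
  ∀ (x : Vec n) (w : ℕ → Vec g), (∀ t, ‖w t‖ ≤ wmax) →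
    ∀ t, ‖closedLoop f π w x t‖ ≤ β t * ‖x‖ + γ * wmax

/-- `π` is incrementally stable with decay `β`. -/
def IsIncrementallyStable {n m g : ℕ} (f : Vec n → Vec m → Vec g → Vec n) (wmax : ℝ)
    (β : ℕ → ℝ) (π : Vec n → Vec m) : Prop :=
  ∀ (x x' : Vec n) (w : ℕ → Vec g), (∀ t, ‖w t‖ ≤ wmax) →
    ∀ t, ‖closedLoop f π w x t - closedLoop f π w x' t‖ ≤ β t * ‖x - x'‖

/-- `H t = ∑_{i=0}^{t-1} β i`. -/
def cumDecay (β : ℕ → ℝ) (t : ℕ) : ℝ := ∑ i ∈ Finset.range t, β i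

/-! ### Problem data -/

/-- The numerical constants on which the implied constants may depend. -/
structure Constants where
  /-- Lipschitz constant of the dynamics -/
  Lf : ℝ
  /-- bound on `‖f (0, 0, 0)‖` -/
  f0 : ℝ
  /-- first local Lipschitz constant of the costs -/
  Lc1 : ℝ
  /-- second local Lipschitz constant of the costs -/
  Lc2 : ℝ
  /-- bound on `|c_t (0, 0)|` -/
  c0 : ℝ
  /-- Lipschitz constant of the controllers -/
  Lπ : ℝ
  /-- bound on `‖π_i 0‖` -/
  π0 : ℝ
  /-- bound on the noise -/
  wmax : ℝ
  /-- norm of the initial state -/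
  x0norm : ℝ
  /-- decay profile given to the algorithm -/
  β : ℕ → ℝ
  /-- gain given to the algorithm -/
  γ : ℝ
  /-- initial value `α_0` -/
  α0 : ℝ
  /-- offset `δ` -/
  δ : ℝ
  /-- growth parameter of the batch lengths -/
  ν : ℝ
  /-- bound on `z / (N (|𝒰| + 1))`, the squared length scale of the first batch -/
  ζ : ℝ
  /-- lower constant in `η_0 ≍ (|𝒰|+1)^{2/3} T^{-2/3} N^{-1/3}` -/
  a1 : ℝ
  /-- upper constant in `η_0 ≍ (|𝒰|+1)^{2/3} T^{-2/3} N^{-1/3}` -/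
  a2 : ℝ

/-- The sign conditions on the constants. -/
structure Constants.Valid (D : Constants) : Prop where
  Lf : 1 ≤ D.Lf
  Lc1 : 0 < D.Lc1
  Lc2 : 0 < D.Lc2
  c0 : 0 ≤ D.c0
  π0 : 0 ≤ D.π0
  wmax : 0 < D.wmax
  x0norm : 0 < D.x0norm
  β : IsDecay D.β
  γ : 0 < D.γ
  α0 : 1 < D.α0
  ν : 0 < D.ν
  a1 : 0 < D.a1

/-- A control problem: dynamics, pool of `N` controllers, cost functions, noise sequence and
initial state. -/
structure Plant (n m g N : ℕ) where
  f : Vec n → Vec m → Vec g → Vec n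
  π : Fin N → Vec n → Vec m
  c : ℕ → Vec n → Vec m → ℝ
  w : ℕ → Vec g
  x₀ : Vec n

/-- The assumptions on dynamics, noise, costs, controllers and initial state. -/
structure Plant.Regular {n m g N : ℕ} (D : Constants) (P : Plant n m g N) : Prop where
  dyn_lipschitz : ∀ x x' u u' w w', ‖w‖ ≤ D.wmax → ‖w'‖ ≤ D.wmax →
    ‖P.f x u w - P.f x' u' w'‖ ≤ D.Lf * (‖x - x'‖ + ‖u - u'‖ + ‖w - w'‖)
  dyn_zero : ‖P.f 0 0 0‖ ≤ D.f0
  noise : ∀ t, ‖P.w t‖ ≤ D.wmax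
  cost_nonneg : ∀ t x u, 0 ≤ P.c t x u
  cost_lipschitz : ∀ t x x' u u', |P.c t x u - P.c t x' u'| ≤
    (D.Lc1 * (max ‖x‖ ‖x'‖ + max ‖u‖ ‖u'‖) + D.Lc2) * (‖x - x'‖ + ‖u - u'‖)
  cost_zero : ∀ t, |P.c t 0 0| ≤ D.c0
  ctrl_lipschitz : ∀ i x x', ‖P.π i x - P.π i x'‖ ≤ D.Lπ * ‖x - x'‖
  ctrl_zero : ∀ i, ‖P.π i 0‖ ≤ D.π0
  init : ‖P.x₀‖ = D.x0norm

/-- The set `𝒮` of stabilizing controllers. -/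
def stabilizing {n m g N : ℕ} (D : Constants) (P : Plant n m g N) : Set (Fin N) :=
  {i | IsISS P.f D.wmax D.β D.γ (P.π i) ∧ IsIncrementallyStable P.f D.wmax D.β (P.π i)}

/-- The set `𝒰` of destabilizing controllers. -/
def destabilizing {n m g N : ℕ} (D : Constants) (P : Plant n m g N) : Set (Fin N) :=
  {i | ¬ IsISS P.f D.wmax D.β D.γ (P.π i)}

/-- `∑_{t=0}^{T} c_t (x_t, π_i (x_t))` when controller `i` is used throughout, from `x₀`. -/
def singleCost {n m g N : ℕ} (P : Plant n m g N) (T : ℕ) (i : Fin N) : ℝ :=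
  ∑ t ∈ Finset.range (T + 1),
    P.c t (closedLoop P.f (P.π i) P.w P.x₀ t) (P.π i (closedLoop P.f (P.π i) P.w P.x₀ t))

/-! ### The algorithm -/

/-- The remaining inputs of the algorithm: the horizon, the initial learning rate, the batch
lengths, and the rule by which the new value of `α` is picked whenever it has to be increased.
The rule may use all previous controller choices (most recent first), which determine the
whole history. -/
structure AlgInput (N : ℕ) where
  T : ℕ
  η₀ : ℝ
  τ : ℕ → ℕ
  pick : List (Fin N) → ℝ → ℕ → ℝ → ℝ

/-- `pick h α s y` is some `α' > α` with `α'^{s+1}‖x₀‖ ≤ y - δ < α'^{s+2}‖x₀‖`, whenever the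
algorithm may ask for one. Here `y` is the current state norm. -/
def ValidPick {N : ℕ} (D : Constants) (pick : List (Fin N) → ℝ → ℕ → ℝ → ℝ) : Prop :=
  ∀ (h : List (Fin N)) (α : ℝ) (s : ℕ) (y : ℝ), 1 < α → α ^ (s + 2) * D.x0norm ≤ y - D.δ →
    α < pick h α s y ∧ pick h α s y ^ (s + 1) * D.x0norm ≤ y - D.δ ∧
      y - D.δ < pick h α s y ^ (s + 2) * D.x0norm

/-- What the algorithm holds at the start of batch `b`. -/
structure State (n N : ℕ) where
  /-- the batch index `b` -/
  b : ℕ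
  /-- the start time `t_b` -/
  t : ℕ
  /-- the state `x_{t_b}` -/
  x : Vec n
  /-- the pool `𝒫_b` -/
  pool : Finset (Fin N)
  /-- the weights `W_b` -/
  W : Fin N → ℝ
  /-- the value `α_b` -/
  α : ℝ
  /-- the value `s_b` -/
  s : ℕ
  /-- the choices `K_{b-1}, …, K_0` -/
  hist : List (Fin N)
  /-- the cost `∑_{t < t_b} c_t (x_t, u_t)` incurred so far -/
  cost : ℝ

/-- The initial state of the algorithm. -/
def initState {n m g N : ℕ} (D : Constants) (P : Plant n m g N) : State n N where
  b := 0
  t := 0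
  x := P.x₀
  pool := Finset.univ
  W := fun _ => 0
  α := D.α0
  s := 0
  hist := []
  cost := 0

/-- The learning rate `η_b = η_0 / α_b^{2 s_b}`. -/
def rate {n N : ℕ} (A : AlgInput N) (σ : State n N) : ℝ := A.η₀ / σ.α ^ (2 * σ.s)

/-- The sampling distribution `p_b` on `𝒫_b`. -/
def prob {n N : ℕ} (A : AlgInput N) (σ : State n N) (k : Fin N) : ℝ :=
  Real.exp (-(rate A σ * σ.W k)) / ∑ i ∈ σ.pool, Real.exp (-(rate A σ * σ.W i))

/-- The state `x_{t_b + j}` when controller `k` is used from time `t_b` on. -/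
def inBatch {n m g N : ℕ} (P : Plant n m g N) (σ : State n N) (k : Fin N) (j : ℕ) : Vec n :=
  closedLoop P.f (P.π k) (fun i => P.w (σ.t + i)) σ.x j

/-- The stability test fails on observing the `j`-th new state `x_{t_b + j}` of the batch. -/
def Violates {n m g N : ℕ} (D : Constants) (P : Plant n m g N) (σ : State n N) (k : Fin N)
    (j : ℕ) : Prop :=
  D.β j * ‖σ.x‖ + D.γ * D.wmax < ‖inBatch P σ k j‖

/-- Planned number of steps of the batch: times `t_b, …, min (t_b + τ_b - 1) T`. -/
def planned {n N : ℕ} (A : AlgInput N) (σ : State n N) : ℕ := min (A.τ σ.b) (A.T + 1 - σ.t)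

/-- The break statement is activated in this batch. -/
def Breaks {n m g N : ℕ} (D : Constants) (P : Plant n m g N) (A : AlgInput N) (σ : State n N)
    (k : Fin N) : Prop :=
  ∃ j, 1 ≤ j ∧ j ≤ planned A σ ∧ Violates D P σ k j

open Classical in
/-- The actual number of steps `t_{b+1} - t_b`: up to the first violation, if there is one. -/
def batchLen {n m g N : ℕ} (D : Constants) (P : Plant n m g N) (A : AlgInput N) (σ : State n N)
    (k : Fin N) : ℕ :=
  if h : Breaks D P A σ k then Nat.find h else planned A σ

/-- The batch cost `w_b (k)`. -/
def batchCost {n m g N : ℕ} (D : Constants) (P : Plant n m g N) (A : AlgInput N)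
    (σ : State n N) (k : Fin N) : ℝ :=
  ∑ j ∈ Finset.range (batchLen D P A σ k),
    P.c (σ.t + j) (inBatch P σ k j) (P.π k (inBatch P σ k j))

/-- For `α > 1` and `α r ≤ y - δ`, the unique `s ≥ 1` with `α^s r ≤ y - δ < α^{s+1} r`. -/
def level (r δ α y : ℝ) : ℕ := ⌊Real.logb α ((y - δ) / r)⌋₊

lemma level_spec {r δ α y : ℝ} (hr : 0 < r) (hα : 1 < α) (hy : α * r + δ ≤ y) :
    1 ≤ level r δ α y ∧ α ^ level r δ α y * r ≤ y - δ ∧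
      y - δ < α ^ (level r δ α y + 1) * r := by
  have h1 : α ≤ (y - δ) / r := by rw [le_div_iff₀ hr]; linarith
  have h0 : 0 < (y - δ) / r := by linarith
  have hl : 1 ≤ Real.logb α ((y - δ) / r) := by
    rw [Real.le_logb_iff_rpow_le hα h0]; simpa using h1
  have ha : (level r δ α y : ℝ) ≤ Real.logb α ((y - δ) / r) :=
    Nat.floor_le (by linarith)
  have hb : Real.logb α ((y - δ) / r) < (level r δ α y : ℝ) + 1 := Nat.lt_floor_add_one _
  refine ⟨Nat.le_floor (by simpa using hl), ?_, ?_⟩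
  · rw [Real.le_logb_iff_rpow_le hα h0, Real.rpow_natCast, le_div_iff₀ hr] at ha
    exact ha
  · rw [Real.logb_lt_iff_lt_rpow hα h0] at hb
    have : ((level r δ α y : ℝ) + 1) = ((level r δ α y + 1 : ℕ) : ℝ) := by push_cast; ring
    rw [this, Real.rpow_natCast, div_lt_iff₀ hr] at hb
    exact hb

open Classical in
/-- The new pair `(α_{b+1}, s_{b+1})` when the next batch starts with state norm `y`;
`h` is the list of choices including `K_b`. -/
def nextLevel {n N : ℕ} (D : Constants) (A : AlgInput N) (σ : State n N) (h : List (Fin N))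
    (y : ℝ) : ℝ × ℕ :=
  if σ.α * D.x0norm + D.δ ≤ y then
    if σ.s + 1 < level D.x0norm D.δ σ.α y then (A.pick h σ.α σ.s y, σ.s + 1)
    else (σ.α, level D.x0norm D.δ σ.α y)
  else (σ.α, 0)

open Classical in
/-- One pass through the batch loop, with sampled controller `K_b = k`. -/
def step {n m g N : ℕ} (D : Constants) (P : Plant n m g N) (A : AlgInput N) (σ : State n N)
    (k : Fin N) : State n N where
  b := σ.b + 1
  t := σ.t + batchLen D P A σ k
  x := inBatch P σ k (batchLen D P A σ k)
  pool := if Breaks D P A σ k then σ.pool.erase k else σ.pool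
  W := fun i =>
    if (nextLevel D A σ (k :: σ.hist) ‖inBatch P σ k (batchLen D P A σ k)‖).2 ≠ σ.s then 0
    else σ.W i + if i = k then batchCost D P A σ k / prob A σ k else 0
  α := (nextLevel D A σ (k :: σ.hist) ‖inBatch P σ k (batchLen D P A σ k)‖).1
  s := (nextLevel D A σ (k :: σ.hist) ‖inBatch P σ k (batchLen D P A σ k)‖).2
  hist := k :: σ.hist
  cost := σ.cost + batchCost D P A σ k

open Classical in
/-- Expected total cost when at most `B` further batches are run from `σ`, the choices
`K_b ∼ p_b` being drawn successively (iterated conditional expectation). The algorithm stops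
when the horizon is exhausted or the pool is empty. -/
def expectedCost {n m g N : ℕ} (D : Constants) (P : Plant n m g N) (A : AlgInput N) :
    ℕ → State n N → ℝ
  | 0, σ => σ.cost
  | B + 1, σ =>
    if A.T < σ.t ∨ σ.pool = ∅ then σ.cost
    else ∑ k ∈ σ.pool, prob A σ k * expectedCost D P A B (step D P A σ k)

/-- The expected regret over times `0, …, T` against controller `i`. Every batch has length at
least one (if `τ_b ≥ 1`), so that `T + 1` batches exhaust the horizon. -/
def regret {n m g N : ℕ} (D : Constants) (P : Plant n m g N) (A : AlgInput N) (i : Fin N) : ℝ :=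
  expectedCost D P A (A.T + 1) (initState D P) - singleCost P A.T i

/-! ### Parameter choices of the theorem -/

/-- Polynomial batches with exponent `1/2`:
`τ_0 = ⌊(z/M)^{1/2}⌋`, `τ_b = ⌈((ν b + z)/M)^{1/2}⌉` for `b ≥ 1`. -/
def polyBatch (M z ν : ℝ) (b : ℕ) : ℕ :=
  if b = 0 then ⌊√(z / M)⌋₊ else ⌈√((ν * b + z) / M)⌉₊

/-- The hypotheses of the theorem, for a pool with `|𝒰| = u` and best stabilizing controller
`i`. -/
structure Admissible {n m g N : ℕ} (D : Constants) (P : Plant n m g N) (A : AlgInput N)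
    (z : ℝ) (u : ℕ) (i : Fin N) : Prop where
  regular : P.Regular D
  card_destabilizing : (destabilizing D P).ncard = u
  best_mem : i ∈ stabilizing D P
  best_min : ∀ j ∈ stabilizing D P, singleCost P A.T i ≤ singleCost P A.T j
  pick : ValidPick D A.pick
  z_pos : 0 < z
  z_le : z ≤ D.ζ * (N * (u + 1))
  batch : A.τ = polyBatch (N * (u + 1)) z D.ν
  batch_pos : 0 < A.τ 0
  batch_ratio : (A.τ 1 : ℝ) / A.τ 0 * D.β (A.τ 0) ^ 2 < 1 / (2 * √2)
  offset : D.γ * D.wmax / (1 - D.β (A.τ 0)) ≤ D.δ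
  rate_lower : D.a1 * ((u + 1 : ℝ) ^ (2 / 3 : ℝ) / ((A.T : ℝ) ^ (2 / 3 : ℝ) * (N : ℝ) ^ (1 / 3 : ℝ)))
    ≤ A.η₀
  rate_upper : A.η₀ ≤
    D.a2 * ((u + 1 : ℝ) ^ (2 / 3 : ℝ) / ((A.T : ℝ) ^ (2 / 3 : ℝ) * (N : ℝ) ^ (1 / 3 : ℝ)))
  horizon : max ((u : ℝ) ^ (3 / 2 : ℝ) / ((N : ℝ) * (u + 1)) ^ (1 / 2 : ℝ)) ((N : ℝ) * (u + 1))
    ≤ A.T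

end DBAR

end

namespace DBAR

/-! ### Closed loops -/

/-! One potential function controls the whole run. Backward induction over the batches
(`Budget.Sound.expectedCost_le`) bounds the expected final cost by the cost so far, plus the
comparator's cost over the remaining times, plus an exponential-weights term, plus a deterministic
`overhead`. At the initial state this becomes `Budget.Sound.regret_le`.

The state enters through `excess`, the positive part of ‖x‖ - δ. The choice of δ makes a complete
batch without violation contract it by β(τ_0), while a batch that breaks sends y to at most a(1 +
y). Each break removes a member of 𝒰, so the fourth powers of the excess at the batch starts sum to
exp(O(|𝒰|)) (`Budget.Sound.excessPotential_step`). Fourth powers appear because batch costs are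
quadratic in the excess and exponential weights pays for their squares.

At level s = 0 the learning rate is exactly η_0. There a fixed-rate round of exponential weights
(`sum_prob_softPotential_le`) compares the played controller with the comparator i restarted from
the current state, and incremental stability moves i to its own trajectory for O(H(τ)). At s ≥ 1 the
excess is at least ‖x_0‖, so the entire batch cost is charged to its fourth power and learning is
ignored; the growth of α and the reduced rates need no analysis. Before the horizon, level 0 is left
only through a break, so there are at most |𝒰| + 1 learning phases, each costing log N / η_0.

With Z = T^{2/3} M^{1/3} and ρ = (T/M)^{1/3} there are O(Z) batches, of length O(ρ), and η_0 N ρ² =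
O(1). Hence `exists_regret_le`: the regret is of order Z(1 + log T) + Z H(cρ) + ρ exp(κ|𝒰|). Since
Zρ = T, the middle term is o(1) T by Cesàro means, or Z(1 + log T) under the harmonic assumption. -/

lemma closedLoop_add {n m g : ℕ} (f : Vec n → Vec m → Vec g → Vec n) (π : Vec n → Vec m)
    (w : ℕ → Vec g) (x : Vec n) (t j : ℕ) :
    closedLoop f π w x (t + j) = closedLoop f π (fun i => w (t + i)) (closedLoop f π w x t) j := by
  induction j with
  | zero => rfl
  | succ j ih => rw [← add_assoc]; simp only [closedLoop, ih]

lemma IsDecay.nonneg {β : ℕ → ℝ} (hβ : IsDecay β) (t : ℕ) : 0 ≤ β t :=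
  hβ.antitone.le_of_tendsto hβ.tendsto t

lemma IsDecay.le_one {β : ℕ → ℝ} (hβ : IsDecay β) (t : ℕ) : β t ≤ 1 := by
  rw [← hβ.zero]; exact hβ.antitone (Nat.zero_le t)

lemma cumDecay_nonneg {β : ℕ → ℝ} (hβ : IsDecay β) (t : ℕ) : 0 ≤ cumDecay β t :=
  Finset.sum_nonneg fun i _ => hβ.nonneg i

lemma cumDecay_mono {β : ℕ → ℝ} (hβ : IsDecay β) : Monotone (cumDecay β) := fun _ _ h =>
  Finset.sum_le_sum_of_subset_of_nonneg (Finset.range_mono h) fun i _ _ => hβ.nonneg i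

lemma cumDecay_le {β : ℕ → ℝ} (hβ : IsDecay β) (t : ℕ) : cumDecay β t ≤ t := by
  simpa [cumDecay] using Finset.sum_le_card_nsmul (Finset.range t) β 1 fun i _ => hβ.le_one i

/-! ### One batch -/

section Batch

variable {n m g N : ℕ} {D : Constants} {P : Plant n m g N} {A : AlgInput N} {σ : State n N}
  {k : Fin N}

/-- The states within a batch form a closed loop of `k` under shifted noise, so one observed
violation refutes ISS. Hence controllers in 𝒮 never leave the pool. -/
lemma mem_destabilizing_of_breaks (hP : P.Regular D) (h : Breaks D P A σ k) :
    k ∈ destabilizing D P := by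
  obtain ⟨j, -, -, hj⟩ := h
  exact fun hk => absurd (hk σ.x (fun i => P.w (σ.t + i)) (fun t => hP.noise _) j) (not_le.2 hj)

lemma batchLen_of_not_breaks (h : ¬ Breaks D P A σ k) : batchLen D P A σ k = planned A σ :=
  dif_neg h

lemma batchLen_le_planned : batchLen D P A σ k ≤ planned A σ := by
  classical
  unfold batchLen
  split_ifs with h
  · exact (Nat.find_spec h).2.1
  · exact le_rfl

lemma one_le_batchLen (h1 : 1 ≤ planned A σ) : 1 ≤ batchLen D P A σ k := by
  classical
  unfold batchLen
  split_ifs with h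
  · exact (Nat.find_spec h).1
  · exact h1

lemma norm_inBatch_le_of_lt (hβ : IsDecay D.β) (hγ : 0 ≤ D.γ * D.wmax) {j : ℕ}
    (hj : j < batchLen D P A σ k) :
    ‖inBatch P σ k j‖ ≤ D.β j * ‖σ.x‖ + D.γ * D.wmax := by
  classical
  rcases Nat.eq_zero_or_pos j with rfl | hj0
  · simp only [inBatch, closedLoop, hβ.zero, one_mul]
    linarith
  · by_contra hcon
    have hj' := hj.le.trans batchLen_le_planned
    have h : Breaks D P A σ k := ⟨j, hj0, hj', not_le.1 hcon⟩
    rw [batchLen, dif_pos h] at hj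
    exact Nat.find_min h hj ⟨hj0, hj', not_le.1 hcon⟩

lemma norm_inBatch_planned_le (h1 : 1 ≤ planned A σ) (h : ¬ Breaks D P A σ k) :
    ‖inBatch P σ k (planned A σ)‖ ≤ D.β (planned A σ) * ‖σ.x‖ + D.γ * D.wmax := by
  by_contra hcon
  exact h ⟨_, h1, le_rfl, not_le.1 hcon⟩

lemma norm_ctrl_le (hP : P.Regular D) (k : Fin N) (x : Vec n) :
    ‖P.π k x‖ ≤ |D.Lπ| * ‖x‖ + D.π0 := by
  have h1 := hP.ctrl_lipschitz k x 0
  have h2 := hP.ctrl_zero k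
  have h3 : ‖P.π k x‖ ≤ ‖P.π k x - P.π k 0‖ + ‖P.π k 0‖ := by
    simpa using norm_add_le (P.π k x - P.π k 0) (P.π k 0)
  rw [sub_zero] at h1
  have h4 := mul_le_mul_of_nonneg_right (le_abs_self D.Lπ) (norm_nonneg x)
  linarith

lemma norm_dyn_le (hD : D.Valid) (hP : P.Regular D) (k : Fin N) (x : Vec n) {w : Vec g}
    (hw : ‖w‖ ≤ D.wmax) :
    ‖P.f x (P.π k x) w‖ ≤ |D.f0| + D.Lf * ((1 + |D.Lπ|) * ‖x‖ + D.π0 + D.wmax) := by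
  have h1 := hP.dyn_lipschitz x 0 (P.π k x) 0 w 0 hw (by simpa using hD.wmax.le)
  have h2 : ‖P.f x (P.π k x) w‖ ≤ ‖P.f x (P.π k x) w - P.f 0 0 0‖ + ‖P.f 0 0 0‖ := by
    simpa using norm_add_le (P.f x (P.π k x) w - P.f 0 0 0) (P.f 0 0 0)
  simp only [sub_zero] at h1
  have h3 := norm_ctrl_le hP k x
  have h4 : D.Lf * (‖x‖ + ‖P.π k x‖ + ‖w‖) ≤
      D.Lf * ((1 + |D.Lπ|) * ‖x‖ + D.π0 + D.wmax) :=
    mul_le_mul_of_nonneg_left (by linarith) (by linarith [hD.Lf])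
  have h5 := hP.dyn_zero.trans (le_abs_self D.f0)
  linarith

/-- The amount by which a state norm exceeds the offset `δ`. -/
noncomputable def excess {n : ℕ} (D : Constants) (x : Vec n) : ℝ := max (‖x‖ - D.δ) 0

lemma excess_nonneg {n : ℕ} (D : Constants) (x : Vec n) : 0 ≤ excess D x := le_max_right _ _

lemma norm_le_excess {n : ℕ} (D : Constants) (x : Vec n) : ‖x‖ ≤ excess D x + D.δ := by
  have := le_max_left (‖x‖ - D.δ) 0
  unfold excess
  linarith

/-- In a batch of full length without a violation the excess contracts. -/
lemma excess_step_le (hβ : IsDecay D.β) (hδ : D.γ * D.wmax ≤ D.δ * (1 - D.β (A.τ 0)))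
    (h1 : 1 ≤ planned A σ) (hτ : A.τ 0 ≤ planned A σ)
    (h : ¬ Breaks D P A σ k) :
    excess D (step D P A σ k).x ≤ D.β (A.τ 0) * excess D σ.x := by
  have h2 := norm_inBatch_planned_le h1 h
  have h3 := hβ.antitone hτ
  have h4 := mul_le_mul_of_nonneg_right h3 (norm_nonneg σ.x)
  have h5 := mul_le_mul_of_nonneg_left (norm_le_excess D σ.x) (hβ.nonneg (A.τ 0))
  have hx : (step D P A σ k).x = inBatch P σ k (planned A σ) := by
    simp only [step]; rw [batchLen_of_not_breaks h]
  rw [hx]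
  refine max_le ?_ (mul_nonneg (hβ.nonneg _) (excess_nonneg _ _))
  -- The lower bound on δ gives β(τ_0)(y + δ) + γ w_max ≤ β(τ_0) y + δ, where y is the old excess.
  nlinarith

/-- Every state of the batch before the last obeys the stability test, so only the final transition
is uncontrolled, and one step of Lipschitz dynamics grows at most linearly. The constant therefore
does not depend on the batch length. -/
lemma exists_growth_const (hD : D.Valid) : ∃ a : ℝ, 1 ≤ a ∧
    ∀ (n m g N : ℕ) (P : Plant n m g N) (A : AlgInput N) (σ : State n N) (k : Fin N),
      P.Regular D → 0 ≤ D.δ → 1 ≤ planned A σ →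
        excess D (step D P A σ k).x ≤ a * (1 + excess D σ.x) := by
  have hγ : 0 ≤ D.γ * D.wmax := (mul_pos hD.γ hD.wmax).le
  have hL := hD.Lf
  have hp := abs_nonneg D.Lπ
  have hf := abs_nonneg D.f0
  have hπ := hD.π0
  have hw := hD.wmax
  refine ⟨1 + (|D.f0| + D.Lf * ((1 + |D.Lπ|) * (|D.δ| + D.γ * D.wmax) + D.π0 + D.wmax))
    + D.Lf * (1 + |D.Lπ|), ?_, ?_⟩
  · have : 0 ≤ |D.δ| := abs_nonneg _
    have h1 : 0 ≤ D.Lf * (1 + |D.Lπ|) := by positivity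
    have h2 : 0 ≤ D.Lf * ((1 + |D.Lπ|) * (|D.δ| + D.γ * D.wmax) + D.π0 + D.wmax) := by positivity
    linarith
  · intro n m g N P A σ k hP hδ h1
    rw [abs_of_nonneg hδ]
    set c := |D.f0| + D.Lf * ((1 + |D.Lπ|) * (D.δ + D.γ * D.wmax) + D.π0 + D.wmax) with hc
    have hc0 : 0 ≤ c := by positivity
    have hLL : 0 ≤ D.Lf * (1 + |D.Lπ|) := by positivity
    have hy := excess_nonneg D σ.x
    obtain ⟨l, hl⟩ : ∃ l, batchLen D P A σ k = l + 1 :=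
      ⟨_, (Nat.sub_add_cancel (one_le_batchLen h1)).symm⟩
    have h2 : ‖inBatch P σ k l‖ ≤ excess D σ.x + D.δ + D.γ * D.wmax := by
      have h3 := norm_inBatch_le_of_lt (P := P) (A := A) (σ := σ) (k := k) hD.β hγ
        (j := l) (by omega)
      have h4 := mul_le_mul_of_nonneg_right (hD.β.le_one l) (norm_nonneg σ.x)
      have h5 := norm_le_excess D σ.x
      linarith
    have h3 : ‖(step D P A σ k).x‖ ≤ c + D.Lf * (1 + |D.Lπ|) * excess D σ.x := by
      have h4 : (step D P A σ k).x =
          P.f (inBatch P σ k l) (P.π k (inBatch P σ k l)) (P.w (σ.t + l)) := by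
        simp only [step, hl]; rfl
      rw [h4]
      refine (norm_dyn_le hD hP k _ (hP.noise _)).trans ?_
      have := mul_le_mul_of_nonneg_left h2 hLL
      rw [hc]
      nlinarith
    have h6 : excess D (step D P A σ k).x ≤ c + D.Lf * (1 + |D.Lπ|) * excess D σ.x :=
      max_le (by linarith) (by positivity)
    nlinarith [mul_nonneg hc0 hy]

/-! ### Costs -/

lemma batchCost_nonneg (hP : P.Regular D) : 0 ≤ batchCost D P A σ k :=
  Finset.sum_nonneg fun _ _ => hP.cost_nonneg _ _ _

/-- Batch costs and the comparison with the trajectory of a stabilizing controller. -/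
lemma exists_cost_const (hD : D.Valid) : ∃ C : ℝ, 1 ≤ C ∧
    ∀ (n m g N : ℕ) (P : Plant n m g N) (A : AlgInput N) (σ : State n N),
      P.Regular D → 0 ≤ D.δ →
        (∀ k, batchCost D P A σ k ≤ C * batchLen D P A σ k * (1 + excess D σ.x ^ 2)) ∧
        ∀ i ∈ stabilizing D P, batchCost D P A σ i -
          ∑ j ∈ Finset.range (batchLen D P A σ i),
            P.c (σ.t + j) (closedLoop P.f (P.π i) P.w P.x₀ (σ.t + j))
              (P.π i (closedLoop P.f (P.π i) P.w P.x₀ (σ.t + j))) ≤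
          C * cumDecay D.β (batchLen D P A σ i) * (1 + excess D σ.x ^ 2) := by
  have hγ : 0 ≤ D.γ * D.wmax := (mul_pos hD.γ hD.wmax).le
  have hp := abs_nonneg D.Lπ
  have hπ := hD.π0
  have hc0 := hD.c0
  have h1 := hD.Lc1
  have h2 := hD.Lc2
  have hx0 := hD.x0norm
  have hδa := abs_nonneg D.δ
  -- `R` bounds the comparator's trajectory, and `y + R` bounds the states in a batch started at
  -- excess `y`. The constant `κ` then bounds state plus input norms by `κ * (1 + y)`.
  obtain ⟨R, hR⟩ : ∃ R, R = |D.δ| + D.γ * D.wmax + D.x0norm := ⟨_, rfl⟩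
  have hR0 : 0 ≤ R := by rw [hR]; positivity
  obtain ⟨κ, hκ⟩ : ∃ κ, κ = (1 + |D.Lπ|) * (1 + R) + D.π0 := ⟨_, rfl⟩
  have hκ0 : 0 ≤ κ := by rw [hκ]; positivity
  have hκ1 : ∀ y : ℝ, 0 ≤ y → (1 + |D.Lπ|) * (y + R) + D.π0 ≤ κ * (1 + y) := by
    intro y hy
    have : 0 ≤ (1 + |D.Lπ|) * R * y + |D.Lπ| * 1 + D.π0 * y := by positivity
    rw [hκ]; nlinarith
  have hκ2 : ∀ y : ℝ, 0 ≤ y → y + R ≤ κ * (1 + y) := by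
    intro y hy
    have : 0 ≤ |D.Lπ| * (y + R) := by positivity
    nlinarith [hκ1 y hy]
  obtain ⟨E₁, hE₁⟩ : ∃ E, E = 2 * D.Lc1 * κ ^ 2 + 2 * D.Lc2 * κ := ⟨_, rfl⟩
  obtain ⟨E₂, hE₂⟩ : ∃ E, E = (2 * D.Lc1 * κ + 2 * D.Lc2) * ((1 + |D.Lπ|) * (2 * κ)) := ⟨_, rfl⟩
  have hE₁0 : 0 ≤ E₁ := by rw [hE₁]; positivity
  have hE₂0 : 0 ≤ E₂ := by rw [hE₂]; positivity
  refine ⟨1 + D.c0 + E₁ + E₂, by linarith, ?_⟩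
  intro n m g N P A σ hP hδ
  have hy0 : 0 ≤ excess D σ.x := excess_nonneg D σ.x
  have hxy : ‖σ.x‖ ≤ excess D σ.x + D.δ := norm_le_excess D σ.x
  generalize excess D σ.x = y at hy0 hxy ⊢
  have hRδ : R = D.δ + D.γ * D.wmax + D.x0norm := by rw [hR, abs_of_nonneg hδ]
  have hy2 : (1 + y) ^ 2 ≤ 2 * (1 + y ^ 2) := by nlinarith [sq_nonneg (y - 1)]
  have hy1 : 1 + y ≤ 2 * (1 + y ^ 2) := by nlinarith [sq_nonneg (y - 1)]
  have hbatch : ∀ k j, j < batchLen D P A σ k → ‖inBatch P σ k j‖ ≤ y + R := by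
    intro k j hj
    have h3 := norm_inBatch_le_of_lt (P := P) (A := A) (σ := σ) (k := k) hD.β hγ hj
    have h4 := mul_le_mul_of_nonneg_right (hD.β.le_one j) (norm_nonneg σ.x)
    linarith
  have hctrl : ∀ k (x : Vec n), ‖x‖ ≤ y + R → ‖x‖ + ‖P.π k x‖ ≤ κ * (1 + y) := by
    intro k x hx
    have h3 := norm_ctrl_le hP k x
    have h4 := mul_le_mul_of_nonneg_left hx (by positivity : 0 ≤ 1 + |D.Lπ|)
    linarith [hκ1 y hy0]
  constructor
  · intro k
    have hterm : ∀ j ∈ Finset.range (batchLen D P A σ k),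
        P.c (σ.t + j) (inBatch P σ k j) (P.π k (inBatch P σ k j)) ≤ (1 + D.c0 + E₁ + E₂) * (1 + y ^ 2) := by
      intro j hj
      have hx := hctrl k _ (hbatch k j (Finset.mem_range.1 hj))
      generalize inBatch P σ k j = x at hx ⊢
      have h3 := (abs_le.1 (hP.cost_lipschitz (σ.t + j) x 0 (P.π k x) 0)).2
      have h4 := (abs_le.1 (hP.cost_zero (σ.t + j))).2
      simp only [norm_zero, sub_zero, max_eq_left (norm_nonneg _)] at h3
      have h5 : (D.Lc1 * (‖x‖ + ‖P.π k x‖) + D.Lc2) * (‖x‖ + ‖P.π k x‖) ≤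
          (D.Lc1 * (κ * (1 + y)) + D.Lc2) * (κ * (1 + y)) := by gcongr
      have h6 := mul_le_mul_of_nonneg_left hy2 (by positivity : 0 ≤ D.Lc1 * κ ^ 2)
      have h7 := mul_le_mul_of_nonneg_left hy1 (by positivity : 0 ≤ D.Lc2 * κ)
      have h8 : 0 ≤ (1 + E₂) * (1 + y ^ 2) := by positivity
      have h9 : 0 ≤ D.c0 * y ^ 2 := by positivity
      have h10 : E₁ * (1 + y ^ 2) =
          D.Lc1 * κ ^ 2 * (2 * (1 + y ^ 2)) + D.Lc2 * κ * (2 * (1 + y ^ 2)) := by rw [hE₁]; ring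
      linarith
    refine (Finset.sum_le_card_nsmul _ _ _ hterm).trans (le_of_eq ?_)
    rw [Finset.card_range, nsmul_eq_mul]; ring
  · intro i hi
    rw [batchCost, ← Finset.sum_sub_distrib, cumDecay, Finset.mul_sum, Finset.sum_mul]
    refine Finset.sum_le_sum fun j hj => ?_
    have hB := hD.β.nonneg j
    have hb := hbatch i j (Finset.mem_range.1 hj)
    have hstar : ∀ t, ‖closedLoop P.f (P.π i) P.w P.x₀ t‖ ≤ R := by
      intro t
      have h3 := hi.1 P.x₀ P.w hP.noise t
      have h4 := mul_le_mul_of_nonneg_right (hD.β.le_one t) (norm_nonneg P.x₀)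
      rw [hP.init] at h3 h4
      linarith
    have hb' : ‖closedLoop P.f (P.π i) P.w P.x₀ (σ.t + j)‖ ≤ y + R := by linarith [hstar (σ.t + j)]
    -- Incremental stability is applied from time t_b on, to the current state and the comparator's
    -- own state at that time; summing the factors β(j) produces `cumDecay`.
    have hdiff : ‖inBatch P σ i j -
        closedLoop P.f (P.π i) P.w P.x₀ (σ.t + j)‖ ≤ D.β j * (2 * κ * (1 + y)) := by
      have h3 := hi.2 σ.x (closedLoop P.f (P.π i) P.w P.x₀ σ.t) (fun l => P.w (σ.t + l))
        (fun l => hP.noise _) j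
      rw [← closedLoop_add] at h3
      refine h3.trans (mul_le_mul_of_nonneg_left ?_ hB)
      have h4 := norm_sub_le σ.x (closedLoop P.f (P.π i) P.w P.x₀ σ.t)
      have h5 := hstar σ.t
      have h6 := hκ2 y hy0
      linarith
    generalize inBatch P σ i j = x at hb hdiff ⊢
    generalize closedLoop P.f (P.π i) P.w P.x₀ (σ.t + j) = x' at hb' hdiff ⊢
    have h3 := (abs_le.1 (hP.cost_lipschitz (σ.t + j) x x' (P.π i x) (P.π i x'))).2
    have hm : max ‖x‖ ‖x'‖ + max ‖P.π i x‖ ‖P.π i x'‖ ≤ κ * (1 + y) := by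
      have h4 := norm_ctrl_le hP i x
      have h5 := norm_ctrl_le hP i x'
      have h6 := mul_le_mul_of_nonneg_left hb hp
      have h7 := mul_le_mul_of_nonneg_left hb' hp
      have h8 : max ‖P.π i x‖ ‖P.π i x'‖ ≤ |D.Lπ| * (y + R) + D.π0 :=
        max_le (by linarith) (by linarith)
      linarith [max_le hb hb', hκ1 y hy0]
    have hd : ‖x - x'‖ + ‖P.π i x - P.π i x'‖ ≤ (1 + |D.Lπ|) * (D.β j * (2 * κ * (1 + y))) := by
      have h4 := hP.ctrl_lipschitz i x x'
      have h5 := mul_le_mul_of_nonneg_right (le_abs_self D.Lπ) (norm_nonneg (x - x'))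
      have h6 := mul_le_mul_of_nonneg_left hdiff hp
      linarith
    have h4 : (D.Lc1 * (max ‖x‖ ‖x'‖ + max ‖P.π i x‖ ‖P.π i x'‖) + D.Lc2) *
        (‖x - x'‖ + ‖P.π i x - P.π i x'‖) ≤
        (D.Lc1 * (κ * (1 + y)) + D.Lc2) * ((1 + |D.Lπ|) * (D.β j * (2 * κ * (1 + y)))) := by
      gcongr
    have h5 : (D.Lc1 * (κ * (1 + y)) + D.Lc2) * (1 + y) ≤
        (2 * D.Lc1 * κ + 2 * D.Lc2) * (1 + y ^ 2) := by
      have h6 := mul_le_mul_of_nonneg_left hy2 (by positivity : 0 ≤ D.Lc1 * κ)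
      have h7 := mul_le_mul_of_nonneg_left hy1 h2.le
      nlinarith
    have h6 := mul_le_mul_of_nonneg_right h5
      (by positivity : 0 ≤ (1 + |D.Lπ|) * (2 * κ) * D.β j)
    have h7 : 0 ≤ (1 + D.c0 + E₁) * (D.β j * (1 + y ^ 2)) := by positivity
    have h8 : (2 * D.Lc1 * κ + 2 * D.Lc2) * (1 + y ^ 2) * ((1 + |D.Lπ|) * (2 * κ) * D.β j) =
        E₂ * D.β j * (1 + y ^ 2) := by rw [hE₂]; ring
    linarith

/-! ### Levels -/

/-- The relations between `α_b`, `s_b` and the norm of `x_{t_b}`. -/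
structure LevelSpec (D : Constants) (α : ℝ) (s : ℕ) (y : ℝ) : Prop where
  one_lt : 1 < α
  upper : y - D.δ < α ^ (s + 1) * D.x0norm
  lower : s ≠ 0 → α ^ s * D.x0norm ≤ y - D.δ

lemma levelSpec_nextLevel (hD : D.Valid) (hA : ValidPick D A.pick) (hα : 1 < σ.α)
    (h : List (Fin N)) (y : ℝ) :
    LevelSpec D (nextLevel D A σ h y).1 (nextLevel D A σ h y).2 y := by
  unfold nextLevel
  split_ifs with h1 h2
  · obtain ⟨h3, h4, h5⟩ := level_spec hD.x0norm hα h1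
    obtain ⟨h6, h7, h8⟩ := hA h σ.α σ.s y hα
      ((mul_le_mul_of_nonneg_right (pow_le_pow_right₀ hα.le (by omega)) hD.x0norm.le).trans h4)
    exact ⟨hα.trans h6, h8, fun _ => h7⟩
  · obtain ⟨h3, h4, h5⟩ := level_spec hD.x0norm hα h1
    exact ⟨hα, h5, fun _ => h4⟩
  · exact ⟨hα, by simp only [zero_add, pow_one]; linarith, fun h => absurd rfl h⟩

/-- Because α^s ≥ 1, this holds however large α has become. It lets batches at positive levels
charge their cost to a power of the excess. -/
lemma LevelSpec.x0norm_le_excess (hD : D.Valid) {α : ℝ} {s : ℕ} {x : Vec n}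
    (h : LevelSpec D α s ‖x‖) (hs : s ≠ 0) : D.x0norm ≤ excess D x := by
  have h1 := h.lower hs
  have h2 := mul_le_mul_of_nonneg_right (one_le_pow₀ h.one_lt.le (n := s)) hD.x0norm.le
  have h3 := le_max_left (‖x‖ - D.δ) 0
  unfold excess
  linarith

/-- At level 0 the bound on the current state is the very threshold α‖x_0‖ that the next state is
tested against, so leaving level 0 requires the excess to grow. -/
lemma nextLevel_eq_zero (hD : D.Valid) (hσ : LevelSpec D σ.α σ.s ‖σ.x‖) (hs : σ.s = 0)
    {x : Vec n} (hx : excess D x ≤ excess D σ.x) (h : List (Fin N)) :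
    (nextLevel D A σ h ‖x‖).2 = 0 := by
  have h1 := hσ.upper
  rw [hs, zero_add, pow_one] at h1
  have h2 : excess D σ.x < σ.α * D.x0norm :=
    max_lt h1 (mul_pos (by linarith [hσ.one_lt]) hD.x0norm)
  have h3 := le_max_left (‖x‖ - D.δ) 0
  have h4 : ¬ σ.α * D.x0norm + D.δ ≤ ‖x‖ := by
    unfold excess at *
    linarith
  simp [nextLevel, h4]

end Batch

/-! ### Exponential weights on a shrinking pool -/

lemma exp_neg_le_quadratic {x : ℝ} (hx : 0 ≤ x) : Real.exp (-x) ≤ 1 - x + x ^ 2 / 2 := by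
  have h := Real.quadratic_le_exp_of_nonneg hx
  have h0 : 0 < 1 + x + x ^ 2 / 2 := by positivity
  rw [Real.exp_neg]
  calc (Real.exp x)⁻¹ ≤ (1 + x + x ^ 2 / 2)⁻¹ := inv_anti₀ h0 h
    _ ≤ 1 - x + x ^ 2 / 2 := by
      rw [inv_le_iff_one_le_mul₀ h0]
      -- The product of the two quadratics is 1 + x⁴/4.
      nlinarith [sq_nonneg (x ^ 2)]

/-- The exponential-weights potential of a pool relative to a comparator. -/
noncomputable def softPotential {ι : Type*} (η : ℝ) (i : ι) (S : Finset ι) (W : ι → ℝ) : ℝ :=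
  1 / η * Real.log (∑ j ∈ S, Real.exp (-(η * W j))) + W i

/-- The comparator's own summand already gives the bound. It allows the potential to be discarded on
leaving level 0 or at the horizon. -/
lemma softPotential_nonneg {ι : Type*} {η : ℝ} (hη : 0 < η) {i : ι} {S : Finset ι} (hi : i ∈ S)
    (W : ι → ℝ) : 0 ≤ softPotential η i S W := by
  have h : Real.exp (-(η * W i)) ≤ ∑ j ∈ S, Real.exp (-(η * W j)) :=
    Finset.single_le_sum (f := fun j => Real.exp (-(η * W j)))
      (fun j _ => (Real.exp_pos _).le) hi
  have h2 := Real.log_le_log (Real.exp_pos _) h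
  rw [Real.log_exp] at h2
  have h3 := mul_le_mul_of_nonneg_left h2 (one_div_pos.2 hη).le
  have h4 : 1 / η * (-(η * W i)) = -W i := by field_simp
  unfold softPotential
  linarith

lemma softPotential_zero {ι : Type*} (η : ℝ) (i : ι) (S : Finset ι) :
    softPotential η i S (fun _ => 0) = Real.log S.card / η := by
  simp [softPotential]; ring

/-- One round of exponential weights with importance-weighted losses and a shrinking pool. -/
lemma sum_prob_softPotential_le {ι : Type*} [DecidableEq ι] {η : ℝ} (hη : 0 < η) {i : ι}
    {S : Finset ι} (hi : i ∈ S) (W w p : ι → ℝ) (hw : ∀ k, 0 ≤ w k)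
    (hp : ∀ k, p k = Real.exp (-(η * W k)) / ∑ j ∈ S, Real.exp (-(η * W j)))
    (S' : ι → Finset ι) (hS' : ∀ k, S' k ⊆ S) (hi' : ∀ k ∈ S, i ∈ S' k) :
    ∑ k ∈ S, p k * (w k + softPotential η i (S' k) (fun j => W j + if j = k then w k / p k else 0))
      ≤ softPotential η i S W + w i + η / 2 * ∑ k ∈ S, w k ^ 2 := by
  set Φ := ∑ j ∈ S, Real.exp (-(η * W j)) with hΦ
  have hΦpos : 0 < Φ := Finset.sum_pos (fun j _ => Real.exp_pos _) ⟨i, hi⟩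
  have hp0 : ∀ k, 0 < p k := fun k => by rw [hp]; exact div_pos (Real.exp_pos _) hΦpos
  have hpΦ : ∀ k, Real.exp (-(η * W k)) = Φ * p k := fun k => by rw [hp]; field_simp
  have hp1 : ∑ k ∈ S, p k = 1 := by
    simp_rw [hp]; rw [← Finset.sum_div, div_self hΦpos.ne']
  -- For each `k` the decrease of the log-sum cancels the incurred `w k` up to second order.
  -- Multiplying by `p k` turns the comparator's increment `w k / p k` into `w i` after summation,
  -- and the second-order term into `w k ^ 2`.
  have key : ∀ k ∈ S, p k * (w k + softPotential η i (S' k)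
      (fun j => W j + if j = k then w k / p k else 0)) ≤
      p k * softPotential η i S W + (if i = k then w k else 0) + η / 2 * w k ^ 2 := by
    intro k hk
    set Φ' := ∑ j ∈ S' k, Real.exp (-(η * (W j + if j = k then w k / p k else 0))) with hΦ'
    have hΦ'pos : 0 < Φ' := Finset.sum_pos (fun j _ => Real.exp_pos _) ⟨i, hi' k hk⟩
    have h1 : Φ' ≤ Φ * (1 + (-(η * w k) + η ^ 2 * w k ^ 2 / (2 * p k))) := by
      have hx : 0 ≤ η * (w k / p k) := mul_nonneg hη.le (div_nonneg (hw k) (hp0 k).le)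
      -- Passing to a smaller pool only lowers the sum, and only the weight of `k` has changed.
      calc Φ' ≤ ∑ j ∈ S, Real.exp (-(η * (W j + if j = k then w k / p k else 0))) :=
            Finset.sum_le_sum_of_subset_of_nonneg (hS' k) (fun _ _ _ => (Real.exp_pos _).le)
        _ = ∑ j ∈ S, (Real.exp (-(η * W j)) +
              if j = k then Real.exp (-(η * W k)) * (Real.exp (-(η * (w k / p k))) - 1) else 0) := by
            refine Finset.sum_congr rfl fun j _ => ?_
            split_ifs with h
            · subst h
              rw [mul_add, neg_add, Real.exp_add]; ring
            · rw [add_zero, add_zero]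
        _ = Φ + Φ * p k * (Real.exp (-(η * (w k / p k))) - 1) := by
            rw [Finset.sum_add_distrib, Finset.sum_ite_eq' S k, if_pos hk, hpΦ k]
        _ ≤ Φ + Φ * p k * ((1 - η * (w k / p k) + (η * (w k / p k)) ^ 2 / 2) - 1) := by
            have := exp_neg_le_quadratic hx
            have h2 : 0 ≤ Φ * p k := (mul_pos hΦpos (hp0 k)).le
            exact add_le_add_right (mul_le_mul_of_nonneg_left (sub_le_sub_right this 1) h2) Φ
        _ = _ := by
            have aux : ∀ a b c : ℝ, b ≠ 0 → a + a * b * (1 - η * (c / b) + (η * (c / b)) ^ 2 / 2 - 1)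
                = a * (1 + (-(η * c) + η ^ 2 * c ^ 2 / (2 * b))) := by
              intro a b c hb
              field_simp
              ring
            exact aux Φ (p k) (w k) (hp0 k).ne'
    have h2 : Real.log Φ' ≤ Real.log Φ + (-(η * w k) + η ^ 2 * w k ^ 2 / (2 * p k)) := by
      have hpos : 0 < 1 + (-(η * w k) + η ^ 2 * w k ^ 2 / (2 * p k)) :=
        pos_of_mul_pos_right (hΦ'pos.trans_le h1) hΦpos.le
      calc Real.log Φ' ≤ Real.log (Φ * (1 + (-(η * w k) + η ^ 2 * w k ^ 2 / (2 * p k)))) :=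
            Real.log_le_log hΦ'pos h1
        _ = Real.log Φ + Real.log (1 + (-(η * w k) + η ^ 2 * w k ^ 2 / (2 * p k))) :=
            Real.log_mul hΦpos.ne' hpos.ne'
        _ ≤ _ := by have := Real.log_le_sub_one_of_pos hpos; linarith
    have h3 : softPotential η i (S' k) (fun j => W j + if j = k then w k / p k else 0) ≤
        softPotential η i S W - w k + η / 2 * (w k ^ 2 / p k) + (if i = k then w k / p k else 0) := by
      have h4 := mul_le_mul_of_nonneg_left h2 (one_div_pos.2 hη).le
      have h5 : 1 / η * (Real.log Φ + (-(η * w k) + η ^ 2 * w k ^ 2 / (2 * p k))) =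
          1 / η * Real.log Φ - w k + η / 2 * (w k ^ 2 / p k) := by
        have := (hp0 k).ne'
        field_simp
        ring
      rw [h5] at h4
      simp only [softPotential]
      linarith
    have h6 := mul_le_mul_of_nonneg_left h3 (hp0 k).le
    have h7 : p k * (η / 2 * (w k ^ 2 / p k)) = η / 2 * w k ^ 2 := by
      have := (hp0 k).ne'
      field_simp
    have h8 : p k * (if i = k then w k / p k else 0) = if i = k then w k else 0 := by
      have := (hp0 k).ne'
      split_ifs
      · field_simp
      · simp
    calc _ = p k * w k + p k * softPotential η i (S' k)
          (fun j => W j + if j = k then w k / p k else 0) := mul_add _ _ _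
      _ ≤ _ := by nlinarith
  refine (Finset.sum_le_sum key).trans (le_of_eq ?_)
  rw [Finset.sum_add_distrib, Finset.sum_add_distrib, ← Finset.sum_mul, hp1, ← Finset.mul_sum,
    Finset.sum_ite_eq S i, if_pos hi, one_mul]

/-! ### Invariants of the batch loop -/

section Induction

variable {n m g N : ℕ}

/-- The number of controllers removed so far. -/
def removed (σ : State n N) : ℕ := (σ.poolᶜ).card

/-- What holds at the start of every batch. -/
structure Reachable (D : Constants) (P : Plant n m g N) (A : AlgInput N) (σ : State n N) :
    Prop where
  pool : ∀ j ∉ σ.pool, j ∈ destabilizing D P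
  level : LevelSpec D σ.α σ.s ‖σ.x‖
  batches : ∑ b ∈ Finset.range (σ.b - removed σ), A.τ b ≤ σ.t

variable {D : Constants} {P : Plant n m g N} {A : AlgInput N} {σ : State n N}

lemma pool_step (hP : P.Regular D) (h : ∀ j ∉ σ.pool, j ∈ destabilizing D P) (k : Fin N) :
    ∀ j ∉ (step D P A σ k).pool, j ∈ destabilizing D P := by
  intro j hj
  simp only [step] at hj
  split_ifs at hj with hb
  · by_cases hjk : j = k
    · subst hjk; exact mem_destabilizing_of_breaks hP hb
    · exact h j fun hj' => hj (Finset.mem_erase.2 ⟨hjk, hj'⟩)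
  · exact h j hj

lemma pool_step_subset (k : Fin N) : (step D P A σ k).pool ⊆ σ.pool := by
  simp only [step]
  split_ifs
  · exact Finset.erase_subset _ _
  · exact subset_rfl

lemma removed_le (h : ∀ j ∉ σ.pool, j ∈ destabilizing D P) :
    removed σ ≤ (destabilizing D P).ncard := by
  rw [removed, ← Set.ncard_coe_finset]
  exact Set.ncard_le_ncard (fun j hj => h j (by simpa using hj)) (Set.toFinite _)

lemma removed_step_of_breaks {k : Fin N} (hk : k ∈ σ.pool) (hb : Breaks D P A σ k) :
    removed (step D P A σ k) = removed σ + 1 := by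
  simp only [removed, step, if_pos hb]
  rw [Finset.compl_erase, Finset.card_insert_of_notMem (by simpa using hk)]

lemma removed_step_of_not_breaks {k : Fin N} (hb : ¬ Breaks D P A σ k) :
    removed (step D P A σ k) = removed σ := by
  simp only [removed, step, if_neg hb]

lemma one_le_planned (hτ : Monotone A.τ) (h0 : 0 < A.τ 0) (ht : σ.t ≤ A.T) :
    1 ≤ planned A σ :=
  le_min (h0.trans_le (hτ (Nat.zero_le _))) (by omega)

/-- A batch that neither breaks nor exhausts the horizon has its full length. -/
lemma planned_eq {k : Fin N} (hb : ¬ Breaks D P A σ k) (ht : (step D P A σ k).t ≤ A.T) :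
    planned A σ = A.τ σ.b := by
  simp only [step, batchLen_of_not_breaks hb, planned] at *
  omega

lemma Reachable.step (hD : D.Valid) (hP : P.Regular D) (hA : ValidPick D A.pick)
    (hτ : Monotone A.τ)
    (h : Reachable D P A σ) {k : Fin N} (hk : k ∈ σ.pool)
    (ht : (step D P A σ k).t ≤ A.T) : Reachable D P A (step D P A σ k) where
  pool := pool_step hP h.pool k
  level := levelSpec_nextLevel hD hA h.level.one_lt _ _
  batches := by
    have h0 := h.batches
    by_cases hb : Breaks D P A σ k
    · rw [removed_step_of_breaks hk hb]
      have : (DBAR.step D P A σ k).b - (removed σ + 1) = σ.b - removed σ := by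
        simp only [DBAR.step]; omega
      rw [this]
      exact h0.trans (Nat.le_add_right _ _)
    · have h1 : (DBAR.step D P A σ k).t = σ.t + A.τ σ.b := by
        rw [← planned_eq hb ht]
        simp only [DBAR.step, batchLen_of_not_breaks hb]
      rw [removed_step_of_not_breaks hb, h1]
      have h2 : (DBAR.step D P A σ k).b = σ.b + 1 := rfl
      rw [h2]
      rcases le_or_gt (removed σ) σ.b with h3 | h3
      · rw [Nat.sub_add_comm h3, Finset.sum_range_succ]
        -- The new full batch has length τ at index `σ.b`, which by monotonicity is at least τ at
        -- the discounted index.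
        exact add_le_add h0 (hτ (Nat.sub_le _ _))
      · rw [Nat.sub_eq_zero_of_le h3]; simp

/-- Cost of controller `i`, used from `x₀` on, over the times `t, …, T`. -/
noncomputable def restCost (P : Plant n m g N) (T : ℕ) (i : Fin N) (t : ℕ) : ℝ :=
  ∑ t' ∈ Finset.Ico t (T + 1),
    P.c t' (closedLoop P.f (P.π i) P.w P.x₀ t') (P.π i (closedLoop P.f (P.π i) P.w P.x₀ t'))

lemma restCost_nonneg (hP : P.Regular D) (T : ℕ) (i : Fin N) (t : ℕ) : 0 ≤ restCost P T i t :=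
  Finset.sum_nonneg fun _ _ => hP.cost_nonneg _ _ _

lemma restCost_add {T t l : ℕ} (h : t + l ≤ T + 1) (i : Fin N) :
    restCost P T i t = (∑ j ∈ Finset.range l, P.c (t + j)
      (closedLoop P.f (P.π i) P.w P.x₀ (t + j))
        (P.π i (closedLoop P.f (P.π i) P.w P.x₀ (t + j)))) + restCost P T i (t + l) := by
  unfold restCost
  rw [← Finset.sum_Ico_consecutive _ (Nat.le_add_right t l) h, Finset.sum_Ico_eq_sum_range,
    Nat.add_sub_cancel_left]

lemma restCost_anti (hP : P.Regular D) {T t l : ℕ} (h : t + l ≤ T + 1) (i : Fin N) :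
    restCost P T i (t + l) ≤ restCost P T i t := by
  rw [restCost_add h i]
  exact le_add_of_nonneg_left (Finset.sum_nonneg fun _ _ => hP.cost_nonneg _ _ _)

/-! ### The potential function and its change in one batch -/

/-- Bounds the fourth powers of all later excesses, if at most `u` controllers get removed. -/
noncomputable def excessPotential (D : Constants) (a : ℝ) (u : ℕ) (σ : State n N) : ℝ :=
  2 * (8 * a ^ 4 + 2) ^ (u - removed σ) * (excess D σ.x ^ 4 + 1)

lemma excess_pow_le_excessPotential (a : ℝ) (u : ℕ) (σ : State n N) :
    excess D σ.x ^ 4 ≤ excessPotential D a u σ := by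
  have h1 : (1 : ℝ) ≤ (8 * a ^ 4 + 2) ^ (u - removed σ) :=
    one_le_pow₀ (by nlinarith [sq_nonneg (a ^ 2)])
  have h2 : 0 ≤ excess D σ.x ^ 4 := pow_nonneg (excess_nonneg _ _) 4
  unfold excessPotential
  nlinarith

lemma add_pow_four_le {y : ℝ} (_hy : 0 ≤ y) : (1 + y) ^ 4 ≤ 8 * (1 + y ^ 4) := by
  have h1 : (1 + y) ^ 2 ≤ 2 * (1 + y ^ 2) := by nlinarith [sq_nonneg (y - 1)]
  have h2 : ((1 + y) ^ 2) ^ 2 ≤ (2 * (1 + y ^ 2)) ^ 2 := by gcongr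
  nlinarith [sq_nonneg (y ^ 2 - 1)]

/-- The coefficients of the potential function of the regret analysis. -/
structure Budget where
  /-- bound on the number of removals -/
  u : ℕ
  /-- growth factor of the excess in a batch that breaks -/
  a : ℝ
  /-- price of a restart -/
  L : ℝ
  /-- price of a batch -/
  EB : ℝ
  /-- price of a removal -/
  Eu : ℝ
  /-- price of the excess -/
  EV : ℝ
  /-- bound on the number of batches -/
  Bm : ℝ

/-- The deterministic part of the potential function. -/
noncomputable def Budget.overhead (G : Budget) (D : Constants) (σ : State n N) : ℝ :=
  G.L * ((G.u - removed σ) + if σ.s = 0 then 0 else 1) + G.EB * (G.Bm + 1 - σ.b)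
    + G.Eu * (G.u - removed σ) + G.EV * excessPotential D G.a G.u σ

/-- The conditions under which the potential function bounds the expected cost. -/
structure Budget.Sound (G : Budget) (D : Constants) (P : Plant n m g N) (A : AlgInput N)
    (i : Fin N) (C : ℝ) (τm : ℕ) : Prop where
  valid : D.Valid
  regular : P.Regular D
  pick : ValidPick D A.pick
  mono : Monotone A.τ
  pos : 0 < A.τ 0
  contr : D.β (A.τ 0) ^ 4 ≤ 1 / 2
  offset : D.γ * D.wmax ≤ D.δ * (1 - D.β (A.τ 0))
  offset_nonneg : 0 ≤ D.δ
  rate_pos : 0 < A.η₀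
  best : i ∈ stabilizing D P
  card : (destabilizing D P).ncard = G.u
  batches : ∀ n, ∑ b ∈ Finset.range n, A.τ b ≤ A.T → (n : ℝ) + G.u ≤ G.Bm
  lengths : ∀ b : ℕ, (b : ℝ) ≤ G.Bm → A.τ b ≤ τm
  growth : ∀ (σ : State n N) k, 1 ≤ planned A σ →
    excess D (step D P A σ k).x ≤ G.a * (1 + excess D σ.x)
  one_le_a : 1 ≤ G.a
  one_le_C : 1 ≤ C
  cost : ∀ (σ : State n N) k,
    batchCost D P A σ k ≤ C * batchLen D P A σ k * (1 + excess D σ.x ^ 2)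
  compare : ∀ σ : State n N, batchCost D P A σ i -
    ∑ j ∈ Finset.range (batchLen D P A σ i),
      P.c (σ.t + j) (closedLoop P.f (P.π i) P.w P.x₀ (σ.t + j))
        (P.π i (closedLoop P.f (P.π i) P.w P.x₀ (σ.t + j))) ≤
    C * cumDecay D.β (batchLen D P A σ i) * (1 + excess D σ.x ^ 2)
  L : Real.log N / A.η₀ = G.L
  EB : 2 * C * cumDecay D.β τm + A.η₀ * N * C ^ 2 * τm ^ 2 ≤ G.EB
  Eu : 2 * C * τm ≤ G.Eu
  EV : 2 * C * τm + A.η₀ * N * C ^ 2 * τm ^ 2 ≤ G.EV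
  EV' : C * τm * (2 / D.x0norm ^ 4 + 1) ≤ G.EV

variable {G : Budget} {i : Fin N} {C : ℝ} {τm : ℕ}

lemma Budget.Sound.EB_nonneg (hG : G.Sound D P A i C τm) : 0 ≤ G.EB := by
  have h1 := hG.one_le_C
  have h2 := hG.rate_pos
  have h3 := cumDecay_nonneg hG.valid.β τm
  exact le_trans (by positivity) hG.EB

lemma Budget.Sound.Eu_nonneg (hG : G.Sound D P A i C τm) : 0 ≤ G.Eu := by
  have h1 := hG.one_le_C
  exact le_trans (by positivity) hG.Eu

lemma Budget.Sound.EV_nonneg (hG : G.Sound D P A i C τm) : 0 ≤ G.EV := by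
  have h1 := hG.one_le_C
  have h2 := hG.rate_pos
  exact le_trans (by positivity) hG.EV

lemma Budget.Sound.L_nonneg (hG : G.Sound D P A i C τm) : 0 ≤ G.L := by
  rw [← hG.L]
  exact div_nonneg (Real.log_natCast_nonneg N) hG.rate_pos.le

lemma Budget.Sound.mem_pool (hG : G.Sound D P A i C τm)
    (h : ∀ j ∉ σ.pool, j ∈ destabilizing D P) : i ∈ σ.pool := by
  by_contra hi
  exact h i hi hG.best.1

lemma Budget.Sound.not_breaks (hG : G.Sound D P A i C τm) : ¬ Breaks D P A σ i := fun hb =>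
  mem_destabilizing_of_breaks hG.regular hb hG.best.1

lemma Budget.Sound.removed_le (hG : G.Sound D P A i C τm)
    (h : ∀ j ∉ σ.pool, j ∈ destabilizing D P) : removed σ ≤ G.u :=
  (DBAR.removed_le h).trans hG.card.le

lemma Budget.Sound.b_le (hG : G.Sound D P A i C τm) (h : Reachable D P A σ) (ht : σ.t ≤ A.T) :
    (σ.b : ℝ) ≤ G.Bm := by
  have h1 := hG.batches _ (h.batches.trans ht)
  have h2 := hG.removed_le h.pool
  have h3 : (σ.b : ℝ) ≤ (σ.b - removed σ : ℕ) + G.u := by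
    exact_mod_cast (by omega : σ.b ≤ (σ.b - removed σ) + G.u)
  linarith

lemma Budget.Sound.batchLen_le (hG : G.Sound D P A i C τm) (h : Reachable D P A σ)
    (ht : σ.t ≤ A.T) (k : Fin N) : batchLen D P A σ k ≤ τm :=
  batchLen_le_planned.trans ((min_le_left _ _).trans (hG.lengths _ (hG.b_le h ht)))

lemma Budget.Sound.batchCost_le (hG : G.Sound D P A i C τm) (h : Reachable D P A σ)
    (ht : σ.t ≤ A.T) (k : Fin N) : batchCost D P A σ k ≤ C * τm * (1 + excess D σ.x ^ 2) := by
  have h1 : (batchLen D P A σ k : ℝ) ≤ τm := by exact_mod_cast hG.batchLen_le h ht k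
  have h2 := hG.one_le_C
  refine (hG.cost σ k).trans ?_
  gcongr

lemma Budget.Sound.excess_step_le_of_not_breaks (hG : G.Sound D P A i C τm) {k : Fin N}
    (ht : σ.t ≤ A.T) (ht' : (step D P A σ k).t ≤ A.T) (hb : ¬ Breaks D P A σ k) :
    excess D (step D P A σ k).x ≤ D.β (A.τ 0) * excess D σ.x := by
  have h1 := one_le_planned (σ := σ) hG.mono hG.pos ht
  refine excess_step_le hG.valid.β hG.offset h1 ?_ hb
  rw [planned_eq hb ht']
  exact hG.mono (Nat.zero_le _)

/-- Let v be the fourth power of the excess. A break gives v' ≤ 8a⁴(1 + v), absorbed by spending one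
factor 8a⁴ + 2; otherwise v' ≤ v/2, and the leading factor 2 of the potential leaves a whole v to
spare. Thus every batch releases its own v. -/
lemma Budget.Sound.excessPotential_step (hG : G.Sound D P A i C τm) (h : Reachable D P A σ)
    {k : Fin N} (hk : k ∈ σ.pool) (ht : σ.t ≤ A.T) (ht' : (step D P A σ k).t ≤ A.T) :
    excessPotential D G.a G.u (step D P A σ k) + excess D σ.x ^ 4 ≤
      excessPotential D G.a G.u σ := by
  have hy := excess_nonneg D σ.x
  have hy' := excess_nonneg D (step D P A σ k).x
  have ha := hG.one_le_a
  unfold excessPotential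
  by_cases hb : Breaks D P A σ k
  · have h1 := hG.growth σ k (one_le_planned hG.mono hG.pos ht)
    have h2 := removed_step_of_breaks (P := P) hk hb
    have h3 := hG.removed_le (pool_step (A := A) hG.regular h.pool k)
    rw [h2] at h3
    obtain ⟨e, he⟩ : ∃ e, G.u - removed σ = e + 1 := ⟨G.u - removed σ - 1, by omega⟩
    have he' : G.u - (removed σ + 1) = e := by omega
    rw [h2, he, he', pow_succ (8 * G.a ^ 4 + 2) e]
    have h4 : excess D (step D P A σ k).x ^ 4 ≤ G.a ^ 4 * (8 * (1 + excess D σ.x ^ 4)) := by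
      calc _ ≤ (G.a * (1 + excess D σ.x)) ^ 4 := by gcongr
        _ = G.a ^ 4 * (1 + excess D σ.x) ^ 4 := mul_pow _ _ _
        _ ≤ _ := by have := add_pow_four_le hy; gcongr
    generalize excess D (step D P A σ k).x ^ 4 = v' at h4 ⊢
    have hv : 0 ≤ excess D σ.x ^ 4 := by positivity
    generalize excess D σ.x ^ 4 = v at h4 hv ⊢
    have hE : (1 : ℝ) ≤ (8 * G.a ^ 4 + 2) ^ e := one_le_pow₀ (by nlinarith [sq_nonneg (G.a ^ 2)])
    generalize (8 * G.a ^ 4 + 2) ^ e = E at hE ⊢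
    have h5 := mul_le_mul_of_nonneg_left h4 (by linarith : 0 ≤ 2 * E)
    have h6 : 0 ≤ (E - 1) * (v + 1) := mul_nonneg (by linarith) (by linarith)
    have h7 : 0 ≤ E * v := mul_nonneg (by linarith) hv
    nlinarith
  · have h1 := hG.excess_step_le_of_not_breaks ht ht' hb
    rw [removed_step_of_not_breaks hb]
    have h4 : excess D (step D P A σ k).x ^ 4 ≤ 1 / 2 * excess D σ.x ^ 4 := by
      calc _ ≤ (D.β (A.τ 0) * excess D σ.x) ^ 4 := by gcongr
        _ = D.β (A.τ 0) ^ 4 * excess D σ.x ^ 4 := mul_pow _ _ _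
        _ ≤ _ := by have := hG.contr; gcongr
    generalize excess D (step D P A σ k).x ^ 4 = v' at h4 ⊢
    have hv : 0 ≤ excess D σ.x ^ 4 := by positivity
    generalize excess D σ.x ^ 4 = v at h4 hv ⊢
    have hE : (1 : ℝ) ≤ (8 * G.a ^ 4 + 2) ^ (G.u - removed σ) :=
      one_le_pow₀ (by nlinarith [sq_nonneg (G.a ^ 2)])
    generalize (8 * G.a ^ 4 + 2) ^ (G.u - removed σ) = E at hE ⊢
    have h5 := mul_le_mul_of_nonneg_left h4 (by linarith : 0 ≤ 2 * E)
    have h6 : 0 ≤ (E - 1) * v := mul_nonneg (by linarith) hv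
    nlinarith

-- The indicator of s ≠ 0 in the overhead prepays the return to level 0. Leaving level 0 takes a
-- break, which moves one `G.L` from the removal count to the indicator; the return then spends it.
open Classical in
lemma Budget.Sound.overhead_step (hG : G.Sound D P A i C τm) (h : Reachable D P A σ)
    {k : Fin N} (hk : k ∈ σ.pool) (ht : σ.t ≤ A.T) (ht' : (step D P A σ k).t ≤ A.T) :
    G.overhead D (step D P A σ k) + (if σ.s ≠ 0 ∧ (step D P A σ k).s = 0 then G.L else 0)
      + G.EB + (if Breaks D P A σ k then G.Eu else 0) + G.EV * excess D σ.x ^ 4 ≤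
      G.overhead D σ := by
  have hV := mul_le_mul_of_nonneg_left (hG.excessPotential_step h hk ht ht') hG.EV_nonneg
  have hL := hG.L_nonneg
  have hb' : ((step D P A σ k).b : ℝ) = σ.b + 1 := by simp [step]
  unfold Budget.overhead
  rw [hb']
  by_cases hb : Breaks D P A σ k
  · have hr : (removed (step D P A σ k) : ℝ) = removed σ + 1 := by
      exact_mod_cast removed_step_of_breaks hk hb
    rw [hr, if_pos hb]
    by_cases hs : σ.s = 0 <;> by_cases hs' : (step D P A σ k).s = 0 <;>
      simp only [hs, hs', ne_eq, not_true_eq_false, not_false_eq_true, if_true, if_false,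
        false_and, true_and, and_self] <;> linarith
  · have hr : removed (step D P A σ k) = removed σ := removed_step_of_not_breaks hb
    rw [hr, if_neg hb]
    have h0 : σ.s = 0 → (step D P A σ k).s = 0 := fun hs => by
      refine nextLevel_eq_zero hG.valid h.level hs ?_ (k :: σ.hist)
      refine (hG.excess_step_le_of_not_breaks ht ht' hb).trans ?_
      exact mul_le_of_le_one_left (excess_nonneg _ _) (hG.valid.β.le_one _)
    by_cases hs : σ.s = 0
    · simp only [hs, h0 hs, ne_eq, not_true_eq_false, if_true, if_false, false_and]
      linarith
    · by_cases hs' : (step D P A σ k).s = 0 <;>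
      simp only [hs, hs', ne_eq, not_false_eq_true, if_true, if_false,
        and_false, true_and] <;> linarith

-- Used for the batch that exhausts the horizon: no successor overhead is left to compare with, so
-- the overhead must pay for this batch outright. The `+ 1` in `G.Bm + 1 - σ.b` is reserved for it.
open Classical in
lemma Budget.Sound.le_overhead (hG : G.Sound D P A i C τm) (h : Reachable D P A σ)
    {k : Fin N} (hk : k ∈ σ.pool) (ht : σ.t ≤ A.T) :
    G.EB + (if Breaks D P A σ k then G.Eu else 0) + G.EV * excess D σ.x ^ 4 ≤
      G.overhead D σ := by
  have hV := mul_le_mul_of_nonneg_left (excess_pow_le_excessPotential (D := D) G.a G.u σ)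
    hG.EV_nonneg
  have hr : (removed σ : ℝ) ≤ G.u := by exact_mod_cast hG.removed_le h.pool
  have h1 : 0 ≤ G.L * ((G.u - removed σ) + if σ.s = 0 then 0 else 1) := by
    refine mul_nonneg hG.L_nonneg (add_nonneg (by linarith) ?_)
    split_ifs <;> norm_num
  have h2 : G.EB * 1 ≤ G.EB * (G.Bm + 1 - σ.b) :=
    mul_le_mul_of_nonneg_left (by linarith [hG.b_le h ht]) hG.EB_nonneg
  have h3 : (if Breaks D P A σ k then G.Eu else 0) ≤ G.Eu * (G.u - removed σ) := by
    split_ifs with hb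
    · have h4 := hG.removed_le (pool_step (A := A) hG.regular h.pool k)
      rw [removed_step_of_breaks hk hb] at h4
      have h5 : (removed σ : ℝ) + 1 ≤ G.u := by exact_mod_cast h4
      nlinarith [hG.Eu_nonneg]
    · exact mul_nonneg hG.Eu_nonneg (by linarith)
  unfold Budget.overhead
  linarith

/-- The part of the potential function that comes from exponential weights. -/
noncomputable def weightPotential (A : AlgInput N) (i : Fin N) (σ : State n N) : ℝ :=
  if σ.s = 0 then softPotential A.η₀ i σ.pool σ.W else 0

/-- The weights after the batch, before a possible restart. -/
noncomputable def updatedWeights (D : Constants) (P : Plant n m g N) (A : AlgInput N)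
    (σ : State n N) (k j : Fin N) : ℝ :=
  σ.W j + if j = k then batchCost D P A σ k / prob A σ k else 0

/-- Staying at level 0 keeps the updated weights. A return to level 0 resets them, and the fresh
potential log|pool|/η_0 is at most `G.L`. A positive next level has potential zero, so the old one
is dropped by nonnegativity. -/
lemma Budget.Sound.weightPotential_step_le (hG : G.Sound D P A i C τm)
    (h : Reachable D P A σ) (k : Fin N) :
    weightPotential A i (step D P A σ k) ≤
      (if σ.s = 0 then softPotential A.η₀ i (step D P A σ k).pool (updatedWeights D P A σ k) else 0)
        + if σ.s ≠ 0 ∧ (step D P A σ k).s = 0 then G.L else 0 := by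
  have hi := hG.mem_pool (pool_step (A := A) hG.regular h.pool k)
  unfold weightPotential
  by_cases hs' : (step D P A σ k).s = 0
  · by_cases hs : σ.s = 0
    · rw [if_pos hs', if_pos hs, if_neg (by tauto), add_zero]
      refine le_of_eq (congrArg _ ?_)
      funext j
      have : (nextLevel D A σ (k :: σ.hist) ‖inBatch P σ k (batchLen D P A σ k)‖).2 = 0 := hs'
      simp [step, updatedWeights, this, hs]
    · rw [if_pos hs', if_neg hs, if_pos ⟨hs, hs'⟩, zero_add]
      have hW : (step D P A σ k).W = fun _ => 0 := by
        funext j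
        have : (nextLevel D A σ (k :: σ.hist) ‖inBatch P σ k (batchLen D P A σ k)‖).2 = 0 := hs'
        simp only [step, this]
        rw [if_pos (Ne.symm hs)]
      rw [hW, softPotential_zero, ← hG.L]
      have h1 : 0 < (step D P A σ k).pool.card := Finset.card_pos.2 ⟨i, hi⟩
      have h2 : (step D P A σ k).pool.card ≤ N := by
        simpa using Finset.card_le_univ (step D P A σ k).pool
      refine div_le_div_of_nonneg_right (Real.log_le_log ?_ ?_) hG.rate_pos.le
      · exact_mod_cast h1
      · exact_mod_cast h2
  · have h0 : (if σ.s ≠ 0 ∧ (step D P A σ k).s = 0 then G.L else 0) = 0 :=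
      if_neg fun h => hs' h.2
    rw [if_neg hs', h0, add_zero]
    split_ifs
    · exact softPotential_nonneg hG.rate_pos hi _
    · exact le_rfl

lemma expectedCost_of_lt (h : A.T < σ.t) (B : ℕ) : expectedCost D P A B σ = σ.cost := by
  cases B with
  | zero => rfl
  | succ B => simp [expectedCost, h]

lemma prob_nonneg (k : Fin N) : 0 ≤ prob A σ k :=
  div_nonneg (Real.exp_pos _).le (Finset.sum_nonneg fun _ _ => (Real.exp_pos _).le)

lemma sum_prob (hi : i ∈ σ.pool) : ∑ k ∈ σ.pool, prob A σ k = 1 := by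
  have h : 0 < ∑ j ∈ σ.pool, Real.exp (-(rate A σ * σ.W j)) :=
    Finset.sum_pos (fun j _ => Real.exp_pos _) ⟨i, hi⟩
  unfold prob
  rw [← Finset.sum_div, div_self h.ne']

-- The comparator never breaks, so if `k` does not break either, both batches have the planned
-- length and the comparison of costs applies. If `k` breaks, the lengths may differ; then `G.Eu`,
-- with a share of the excess, pays for the comparator's hypothetical batch.
open Classical in
lemma Budget.Sound.restCost_le (hG : G.Sound D P A i C τm) (h : Reachable D P A σ)
    (ht : σ.t ≤ A.T) (k : Fin N) :
    restCost P A.T i (σ.t + batchLen D P A σ k) - (if Breaks D P A σ k then G.Eu else 0) ≤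
      restCost P A.T i σ.t - batchCost D P A σ i + 2 * C * cumDecay D.β τm
        + 2 * C * τm * excess D σ.x ^ 4 := by
  have hC := hG.one_le_C
  have hH0 := cumDecay_nonneg hG.valid.β τm
  have hH := cumDecay_le hG.valid.β τm
  have hlen : ∀ k, σ.t + batchLen D P A σ k ≤ A.T + 1 := fun k => by
    have := (batchLen_le_planned (D := D) (P := P) (A := A) (σ := σ) (k := k)).trans
      (min_le_right _ _)
    omega
  have hy : excess D σ.x ^ 2 ≤ 1 + excess D σ.x ^ 4 := by
    nlinarith [sq_nonneg (excess D σ.x ^ 2 - 1), sq_nonneg (excess D σ.x ^ 2)]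
  have hy4 : 0 ≤ excess D σ.x ^ 4 := by positivity
  by_cases hb : Breaks D P A σ k
  · rw [if_pos hb]
    have h1 := restCost_anti hG.regular (hlen k) i
    have h2 := hG.batchCost_le h ht i
    have h3 := hG.Eu
    have h4 := mul_le_mul_of_nonneg_left hy (by positivity : 0 ≤ C * τm)
    have h5 : 0 ≤ C * τm * excess D σ.x ^ 4 := by positivity
    have h6 : 0 ≤ C * cumDecay D.β τm := by positivity
    linarith
  · rw [if_neg hb, batchLen_of_not_breaks hb,
      ← batchLen_of_not_breaks (hG.not_breaks (σ := σ)), restCost_add (hlen i) i]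
    have h1 := hG.compare σ
    have h2 : C * cumDecay D.β (batchLen D P A σ i) * (1 + excess D σ.x ^ 2) ≤
        C * cumDecay D.β τm * (1 + excess D σ.x ^ 2) := by
      have := cumDecay_mono hG.valid.β (hG.batchLen_le h ht i)
      gcongr
    have h3 := mul_le_mul_of_nonneg_left hy (by positivity : 0 ≤ C * cumDecay D.β τm)
    have h4 := mul_le_mul_of_nonneg_right hH (by positivity : 0 ≤ C * excess D σ.x ^ 4)
    have h5 : 0 ≤ C * τm * excess D σ.x ^ 4 := by positivity
    linarith

lemma Budget.Sound.sum_batchCost_sq_le (hG : G.Sound D P A i C τm) (h : Reachable D P A σ)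
    (ht : σ.t ≤ A.T) :
    A.η₀ / 2 * ∑ k ∈ σ.pool, batchCost D P A σ k ^ 2 ≤
      A.η₀ * N * C ^ 2 * τm ^ 2 * (1 + excess D σ.x ^ 4) := by
  have hC := hG.one_le_C
  have hη := hG.rate_pos
  have h1 : ∀ k ∈ σ.pool, batchCost D P A σ k ^ 2 ≤
      C ^ 2 * τm ^ 2 * (2 * (1 + excess D σ.x ^ 4)) := by
    intro k _
    have h2 := pow_le_pow_left₀ (batchCost_nonneg hG.regular) (hG.batchCost_le h ht k) 2
    have h3 : (1 + excess D σ.x ^ 2) ^ 2 ≤ 2 * (1 + excess D σ.x ^ 4) := by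
      nlinarith [sq_nonneg (excess D σ.x ^ 2 - 1)]
    refine h2.trans ?_
    rw [mul_pow, mul_pow]
    gcongr
  have h4 := Finset.sum_le_card_nsmul _ _ _ h1
  have h5 : (σ.pool.card : ℝ) ≤ N := by
    exact_mod_cast (by simpa using Finset.card_le_univ σ.pool : σ.pool.card ≤ N)
  rw [nsmul_eq_mul] at h4
  calc _ ≤ A.η₀ / 2 * (N * (C ^ 2 * τm ^ 2 * (2 * (1 + excess D σ.x ^ 4)))) := by
        refine mul_le_mul_of_nonneg_left (h4.trans ?_) (by positivity)
        gcongr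
    _ = _ := by ring

/-! ### Backward induction over the batches -/

/-- The potential function bounds the expected cost. -/
theorem Budget.Sound.expectedCost_le (hG : G.Sound D P A i C τm) (B : ℕ) (σ : State n N)
    (h : Reachable D P A σ) (ht : σ.t ≤ A.T) (hB : A.T + 1 ≤ B + σ.t) :
    expectedCost D P A B σ ≤
      σ.cost + restCost P A.T i σ.t + weightPotential A i σ + G.overhead D σ := by
  classical
  induction B generalizing σ with
  -- Each batch takes at least one time step, so the allowance of batches cannot run out before the
  -- horizon.
  | zero => omega
  | succ B ih =>
    have hi := hG.mem_pool h.pool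
    have hterm : ¬ (A.T < σ.t ∨ σ.pool = ∅) := by
      rintro (h1 | h1)
      · omega
      · rw [h1] at hi; exact absurd hi (Finset.notMem_empty i)
    rw [expectedCost, if_neg hterm]
    have hη := hG.rate_pos
    have hlen := fun k => one_le_batchLen (D := D) (P := P) (k := k)
      (one_le_planned (σ := σ) hG.mono hG.pos ht)
    have hi' := fun k => hG.mem_pool (pool_step (A := A) hG.regular h.pool k)
    set Ψ : Fin N → ℝ := fun k =>
      if σ.s = 0 then softPotential A.η₀ i (step D P A σ k).pool (updatedWeights D P A σ k) else 0
      with hΨ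
    have hΨ0 : ∀ k, 0 ≤ Ψ k := fun k => by
      simp only [hΨ]
      split_ifs
      · exact softPotential_nonneg hη (hi' k) _
      · exact le_rfl
    have hstep : ∀ k ∈ σ.pool, expectedCost D P A B (step D P A σ k) ≤
        σ.cost + batchCost D P A σ k + restCost P A.T i (σ.t + batchLen D P A σ k) + Ψ k
          + (G.overhead D σ - G.EB - (if Breaks D P A σ k then G.Eu else 0)
            - G.EV * excess D σ.x ^ 4) := by
      intro k hk
      have hc : (step D P A σ k).cost = σ.cost + batchCost D P A σ k := rfl
      have htk : (step D P A σ k).t = σ.t + batchLen D P A σ k := rfl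
      rcases lt_or_ge A.T (step D P A σ k).t with ht' | ht'
      · rw [expectedCost_of_lt ht', hc]
        have h1 := hG.le_overhead h hk ht
        have h2 := restCost_nonneg hG.regular A.T i (σ.t + batchLen D P A σ k)
        linarith [hΨ0 k]
      · have h1 := ih (step D P A σ k) (h.step hG.valid hG.regular hG.pick hG.mono hk ht') ht'
          (by have := hlen k; omega)
        have h2 := hG.overhead_step h hk ht ht'
        have h3 := hG.weightPotential_step_le h k
        rw [hc, htk] at h1
        simp only [hΨ]
        linarith
    have hp1 := sum_prob (A := A) hi
    have hfix : ∀ c : ℝ, ∑ k ∈ σ.pool, prob A σ k * c = c := fun c => by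
      rw [← Finset.sum_mul, hp1, one_mul]
    have hy4 : 0 ≤ excess D σ.x ^ 4 := by positivity
    by_cases hs : σ.s = 0
    -- At level 0 the exponent 2s vanishes, so the rate is η_0 whatever α is.
    · have hrate : rate A σ = A.η₀ := by simp [rate, hs]
      have hexp := sum_prob_softPotential_le hη hi σ.W (fun k => batchCost D P A σ k)
        (prob A σ) (fun k => batchCost_nonneg hG.regular)
        (fun k => by rw [prob, hrate]) (fun k => (step D P A σ k).pool)
        (fun k => pool_step_subset k) (fun k _ => hi' k)
      have hsq := hG.sum_batchCost_sq_le h ht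
      calc ∑ k ∈ σ.pool, prob A σ k * expectedCost D P A B (step D P A σ k)
          ≤ ∑ k ∈ σ.pool, (prob A σ k * (batchCost D P A σ k + Ψ k) + prob A σ k *
            (σ.cost + restCost P A.T i σ.t - batchCost D P A σ i + 2 * C * cumDecay D.β τm
              + 2 * C * τm * excess D σ.x ^ 4 + G.overhead D σ - G.EB
              - G.EV * excess D σ.x ^ 4)) := by
            refine Finset.sum_le_sum fun k hk => ?_
            rw [← mul_add]
            refine mul_le_mul_of_nonneg_left ?_ (prob_nonneg k)
            linarith [hstep k hk, hG.restCost_le h ht k]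
        _ = _ := by rw [Finset.sum_add_distrib, hfix]
        _ ≤ _ := by
            have h1 : ∑ k ∈ σ.pool, prob A σ k * (batchCost D P A σ k + Ψ k) ≤
                weightPotential A i σ + batchCost D P A σ i
                  + A.η₀ / 2 * ∑ k ∈ σ.pool, batchCost D P A σ k ^ 2 := by
              simp only [hΨ, hs, if_true, weightPotential]
              exact hexp
            have h2 := hG.EB
            have h3 := mul_le_mul_of_nonneg_right hG.EV hy4
            linarith
    · have hx := h.level.x0norm_le_excess hG.valid hs
      have hx0 := hG.valid.x0norm
      have hC := hG.one_le_C
      -- Since the excess y is at least ‖x_0‖, the constant in 1 + y² is at most y⁴/‖x_0‖⁴; this is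
      -- the origin of the condition `EV'`.
      have hcost : ∀ k, batchCost D P A σ k ≤ G.EV * excess D σ.x ^ 4 := fun k => by
        refine (hG.batchCost_le h ht k).trans ?_
        have h1 : D.x0norm ^ 4 ≤ excess D σ.x ^ 4 := by gcongr
        have h2 : 1 ≤ excess D σ.x ^ 4 / D.x0norm ^ 4 := by
          rw [one_le_div (by positivity)]; exact h1
        have h3 : excess D σ.x ^ 2 ≤ 1 + excess D σ.x ^ 4 := by
          nlinarith [sq_nonneg (excess D σ.x ^ 2 - 1), sq_nonneg (excess D σ.x ^ 2)]
        have h4 : 1 + excess D σ.x ^ 2 ≤ (2 / D.x0norm ^ 4 + 1) * excess D σ.x ^ 4 := by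
          have : (2 / D.x0norm ^ 4 + 1) * excess D σ.x ^ 4 =
            2 * (excess D σ.x ^ 4 / D.x0norm ^ 4) + excess D σ.x ^ 4 := by ring
          linarith
        have h5 := mul_le_mul_of_nonneg_left h4 (by positivity : 0 ≤ C * τm)
        have h6 := mul_le_mul_of_nonneg_right hG.EV' hy4
        linarith
      have hw : weightPotential A i σ = 0 := if_neg hs
      rw [hw, add_zero]
      refine le_trans (Finset.sum_le_sum fun k hk => mul_le_mul_of_nonneg_left ?_ (prob_nonneg k))
        (hfix (σ.cost + restCost P A.T i σ.t + G.overhead D σ)).le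
      have h1 := hstep k hk
      have h2 : Ψ k = 0 := if_neg hs
      have h3 : 0 ≤ if Breaks D P A σ k then G.Eu else 0 := by
        split_ifs
        exacts [hG.Eu_nonneg, le_rfl]
      have h4 : restCost P A.T i (σ.t + batchLen D P A σ k) ≤ restCost P A.T i σ.t := by
        refine restCost_anti hG.regular ?_ i
        have := (batchLen_le_planned (D := D) (P := P) (A := A) (σ := σ) (k := k)).trans
          (min_le_right _ _)
        omega
      linarith [hcost k, hG.EB_nonneg]

/-- The regret bound in terms of the coefficients of the potential function. -/
theorem Budget.Sound.regret_le (hG : G.Sound D P A i C τm) :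
    regret D P A i ≤ G.L * (G.u + 1) + G.EB * (G.Bm + 1) + G.Eu * G.u
      + G.EV * (2 * (8 * G.a ^ 4 + 2) ^ G.u * (D.x0norm ^ 4 + 1)) := by
  have hδ := hG.offset_nonneg
  have hx0 := hG.valid.x0norm
  have hr0 : removed (initState D P) = 0 := by simp [removed, initState]
  have hs0 : (initState D P).s = 0 := rfl
  have h0 : Reachable D P A (initState D P) := by
    refine ⟨fun j hj => absurd (Finset.mem_univ j) hj, ⟨hG.valid.α0, ?_, fun h => absurd rfl h⟩, ?_⟩
    · simp only [initState, hG.regular.init, zero_add, pow_one]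
      nlinarith [hG.valid.α0]
    · simp [initState]
  have h1 := hG.expectedCost_le (A.T + 1) (initState D P) h0 (Nat.zero_le _) (Nat.le_add_right _ _)
  have h2 : restCost P A.T i (initState D P).t = singleCost P A.T i := by
    simp [restCost, singleCost, initState]
  have h3 : weightPotential A i (initState D P) = G.L := by
    rw [weightPotential, if_pos hs0, ← hG.L]
    exact (softPotential_zero A.η₀ i Finset.univ).trans (by simp)
  have h4 : excess D (initState D P).x ≤ D.x0norm :=
    max_le (by simp only [initState, hG.regular.init]; linarith) hx0.le
  have h5 : excessPotential D G.a G.u (initState D P) ≤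
      2 * (8 * G.a ^ 4 + 2) ^ G.u * (D.x0norm ^ 4 + 1) := by
    rw [excessPotential, hr0, Nat.sub_zero]
    have := excess_nonneg D (initState D P).x
    gcongr
  have h6 := mul_le_mul_of_nonneg_left h5 hG.EV_nonneg
  have h7 : G.overhead D (initState D P) = G.L * G.u + G.EB * (G.Bm + 1) + G.Eu * G.u
      + G.EV * excessPotential D G.a G.u (initState D P) := by
    rw [Budget.overhead, hr0, if_pos hs0]
    simp [initState]
  have h8 : (initState D P).cost = 0 := rfl
  unfold regret
  linarith

end Induction

/-! ### Batch lengths -/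

lemma polyBatch_mono {M z ν : ℝ} (hM : 0 < M) (hν : 0 < ν) : Monotone (polyBatch M z ν) := by
  intro b b' hbb
  have hs : √((ν * b + z) / M) ≤ √((ν * b' + z) / M) := by
    have : (b : ℝ) ≤ b' := by exact_mod_cast hbb
    gcongr
  unfold polyBatch
  rcases Nat.eq_zero_or_pos b' with h' | h'
  · have hb : b = 0 := by omega
    rw [h', hb]
  rw [if_neg h'.ne']
  split_ifs with hb
  · rw [hb] at hs
    simp only [Nat.cast_zero, mul_zero, zero_add] at hs
    exact (Nat.floor_le_ceil _).trans (Nat.ceil_mono hs)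
  · exact Nat.ceil_mono hs

lemma polyBatch_le {M z ν : ℝ} (b : ℕ) :
    (polyBatch M z ν b : ℝ) ≤ √((ν * b + z) / M) + 1 := by
  unfold polyBatch
  split_ifs with hb
  · rw [hb]
    simp only [Nat.cast_zero, mul_zero, zero_add]
    exact (Nat.floor_le (Real.sqrt_nonneg _)).trans (by linarith)
  · exact (Nat.ceil_lt_add_one (Real.sqrt_nonneg _)).le

/-- For b = 0 the floor is controlled only by being positive, which suffices as M ≥ 1. For b ≥ 1 one
has b + 1 ≤ 2b and c² ≤ c ≤ ν/2. -/
lemma le_polyBatch {M z ν c : ℝ} (hM : 1 ≤ M) (hz : 0 < z) (hc : 0 < c)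
    (hc1 : c ≤ 1) (hcν : c ≤ ν / 2) (h0 : 0 < polyBatch M z ν 0) (b : ℕ) :
    c * √((b + 1) / M) ≤ polyBatch M z ν b := by
  have hM0 : 0 < M := by linarith
  rcases Nat.eq_zero_or_pos b with rfl | hb
  · have h1 : (1 : ℝ) ≤ polyBatch M z ν 0 := by exact_mod_cast h0
    have h2 : √(((0 : ℕ) + 1) / M) ≤ 1 := by
      exact Real.sqrt_le_iff.2 ⟨zero_le_one, by rw [div_le_iff₀ hM0]; simpa using hM⟩
    nlinarith [Real.sqrt_nonneg ((((0 : ℕ) : ℝ) + 1) / M)]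
  · rw [polyBatch, if_neg hb.ne']
    refine le_trans ?_ (Nat.le_ceil _)
    have hb1 : (1 : ℝ) ≤ b := by exact_mod_cast hb
    refine Real.le_sqrt_of_sq_le ?_
    rw [mul_pow, Real.sq_sqrt (by positivity), ← mul_div_assoc]
    have h2 : c ^ 2 ≤ ν / 2 := by nlinarith
    gcongr
    nlinarith

lemma two_thirds_mul_le_sum_sqrt (n : ℕ) :
    2 / 3 * (n * √n) ≤ ∑ b ∈ Finset.range n, √((b : ℝ) + 1) := by
  induction n with
  | zero => simp
  | succ n ih =>
    rw [Finset.sum_range_succ]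
    push_cast
    have hp := Real.sqrt_nonneg (n : ℝ)
    have hq := Real.sqrt_nonneg ((n : ℝ) + 1)
    have hp2 := Real.sq_sqrt (Nat.cast_nonneg (α := ℝ) n)
    have hq2 := Real.sq_sqrt (by positivity : (0 : ℝ) ≤ (n : ℝ) + 1)
    generalize √(n : ℝ) = p at *
    generalize √((n : ℝ) + 1) = q at *
    have h1 : 2 / 3 * (((n : ℝ) + 1) * q) ≤ 2 / 3 * (n * p) + q := by
      rw [← hq2]
      have h2 : (n : ℝ) = p ^ 2 := hp2.symm
      have h3 : q ^ 2 - p ^ 2 = 1 := by linarith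
      rw [h2]
      -- Once q is rewritten as q(q² - p²), the gap equals (q - p)²(q + 2p)/3.
      have h4 : 0 ≤ (q - p) ^ 2 * (q + 2 * p) := by positivity
      have h5 : q = q * (q ^ 2 - p ^ 2) := by rw [h3, mul_one]
      nlinarith
    linarith

/-- The number of batches is at most of order `T^{2/3} M^{1/3}`. -/
lemma card_batches_le {M z ν c T Z : ℝ} (hM : 1 ≤ M) (hz : 0 < z) (hc : 0 < c)
    (hc1 : c ≤ 1) (hcν : c ≤ ν / 2) (h0 : 0 < polyBatch M z ν 0) (hZ : 0 ≤ Z)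
    (hZT : Z ^ 3 = T ^ 2 * M) {n : ℕ}
    (h : ((∑ b ∈ Finset.range n, polyBatch M z ν b : ℕ) : ℝ) ≤ T) :
    (n : ℝ) ≤ 9 / (4 * c ^ 2) * Z := by
  have hM0 : 0 < M := by linarith
  have h1 : c * (2 / 3 * (n * √n)) / √M ≤ T := by
    refine le_trans ?_ h
    push_cast
    calc c * (2 / 3 * (n * √n)) / √M ≤ c * (∑ b ∈ Finset.range n, √((b : ℝ) + 1)) / √M := by
          have := two_thirds_mul_le_sum_sqrt n
          gcongr
      _ = ∑ b ∈ Finset.range n, c * √(((b : ℝ) + 1) / M) := by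
          rw [Finset.mul_sum, Finset.sum_div]
          refine Finset.sum_congr rfl fun b _ => ?_
          rw [Real.sqrt_div (by positivity), mul_div_assoc]
      _ ≤ _ := Finset.sum_le_sum fun b _ => le_polyBatch hM hz hc hc1 hcν h0 b
  have h2 : (c * (2 / 3 * (n * √n)) / √M) ^ 2 ≤ T ^ 2 := by gcongr
  have h3 : (c * (2 / 3 * (n * √n)) / √M) ^ 2 = c ^ 2 * (4 / 9) * (n : ℝ) ^ 3 / M := by
    rw [div_pow, Real.sq_sqrt hM0.le, mul_pow, mul_pow, mul_pow,
      Real.sq_sqrt (Nat.cast_nonneg n)]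
    ring
  rw [h3, div_le_iff₀ hM0, ← hZT] at h2
  have h4 : (n : ℝ) ^ 3 ≤ 9 / (4 * c ^ 2) * Z ^ 3 := by
    rw [div_mul_eq_mul_div, le_div_iff₀ (by positivity)]
    linarith
  -- A constant that is at least 1 can be replaced by its cube before taking cube roots.
  have h5 : (1 : ℝ) ≤ 9 / (4 * c ^ 2) := by
    rw [one_le_div (by positivity)]
    nlinarith
  have h6 : 9 / (4 * c ^ 2) * Z ^ 3 ≤ (9 / (4 * c ^ 2) * Z) ^ 3 := by
    rw [mul_pow]
    exact mul_le_mul_of_nonneg_right (le_self_pow₀ h5 (by norm_num)) (by positivity)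
  exact le_of_pow_le_pow_left₀ (by norm_num) (by positivity) (h4.trans h6)

/-- The batch lengths are at most of order `(T/M)^{1/3}`. -/
lemma polyBatch_le_floor {M z ν ζ c Z ρ : ℝ} (hM : 0 < M) (hν : 0 < ν) (hc : 0 ≤ c)
    (hz : z ≤ ζ * M) (hZ : Z / M = ρ ^ 2) (hρ : 1 ≤ ρ) {b : ℕ} (hb : (b : ℝ) ≤ c * Z) :
    polyBatch M z ν b ≤ ⌊(2 + ν * c + |ζ|) * ρ⌋₊ := by
  refine Nat.le_floor ((polyBatch_le b).trans ?_)
  have hνc : 0 ≤ ν * c := by positivity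
  have hζ := abs_nonneg ζ
  have h1 : (ν * b + z) / M ≤ ((1 + ν * c + |ζ|) * ρ) ^ 2 := by
    calc (ν * b + z) / M ≤ (ν * (c * Z) + |ζ| * M) / M := by
          have := hz.trans (mul_le_mul_of_nonneg_right (le_abs_self ζ) hM.le)
          gcongr
      _ = ν * c * (Z / M) + |ζ| := by field_simp
      _ ≤ ((1 + ν * c + |ζ|) * ρ) ^ 2 := by
          rw [hZ, mul_pow]
          have h2 : 1 ≤ ρ ^ 2 := one_le_pow₀ hρ
          have h3 : 1 + ν * c + |ζ| ≤ (1 + ν * c + |ζ|) ^ 2 := le_self_pow₀ (by linarith) (by norm_num)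
          have h4 := mul_le_mul_of_nonneg_right h3 (by linarith : 0 ≤ ρ ^ 2)
          have h5 := mul_le_mul_of_nonneg_left h2 hζ
          linarith
  have h2 := Real.sqrt_le_sqrt h1
  rw [Real.sqrt_sq (by positivity)] at h2
  linarith

/-- Collecting the terms of the regret bound. -/
lemma overhead_total_le {a p q l u η logN H τ X a₁ C c₁ c₂ c₃ d e : ℝ} (ha : 1 ≤ a) (hp : 1 ≤ p)
    (hq : 1 ≤ q) (hpqa : p * q ≤ a) (hu : 0 ≤ u) (huq : q ^ 3 = u + 1) (ha₁ : 0 < a₁)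
    (hη : a₁ * (q ^ 2 / (a ^ 2 * p)) ≤ η) (hl : 0 ≤ l) (hN : logN ≤ l) (hH : 0 ≤ H) (hX : 0 ≤ X)
    (hτ : τ ≤ c₂ * (a / (p * q))) (hC : 0 ≤ C) (hc₁ : 0 ≤ c₁) (hc₂ : 0 ≤ c₂)
    (hc₃ : 0 ≤ c₃) (hd : 0 ≤ d) (he : 0 ≤ e) :
    logN / η * (u + 1) + (2 * C * H + c₃ * C ^ 2) * (c₁ * (a ^ 2 * (p * q)) + 1) + 2 * C * τ * u
      + (C * τ * d + c₃ * C ^ 2) * (2 * X * e) ≤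
    (1 / a₁ + (2 * C + c₃ * C ^ 2) * (c₁ + 1) + 2 * C * c₂
      + (C * c₂ * d + c₃ * C ^ 2) * (2 * e)) *
      (a ^ 2 * (p * q) * (1 + l) + a ^ 2 * (p * q) * H + a / (p * q) * X) := by
  have hpq : 1 ≤ p * q := one_le_mul_of_one_le_of_one_le hp hq
  obtain ⟨ρ, hρ⟩ : ∃ ρ, ρ = a / (p * q) := ⟨_, rfl⟩
  have hρ1 : 1 ≤ ρ := by rw [hρ, one_le_div (by linarith)]; exact hpqa
  obtain ⟨Z, hZ⟩ : ∃ Z, Z = a ^ 2 * (p * q) := ⟨_, rfl⟩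
  have hZ1 : 1 ≤ Z := by
    rw [hZ]; exact one_le_mul_of_one_le_of_one_le (one_le_pow₀ ha) hpq
  have huM : u ≤ (p * q) ^ 3 := by
    have h1 : q ^ 3 ≤ (p * q) ^ 3 := by
      have : q ≤ p * q := le_mul_of_one_le_left (by linarith) hp
      gcongr
    linarith
  have hcC : 0 ≤ c₃ * C ^ 2 := by positivity
  -- With M = (pq)³ ≤ a³ = T in the application: ρM = a(pq)² ≤ a²pq = Z, so the removals cost no
  -- more than the batches.
  have hρu : ρ * u ≤ Z := by
    calc ρ * u ≤ ρ * (p * q) ^ 3 := by gcongr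
      _ = a * (p * q) * (p * q) := by rw [hρ]; field_simp
      _ ≤ a * (p * q) * a := by gcongr
      _ = Z := by rw [hZ]; ring
  -- The q³ = |𝒰| + 1 learning phases, each of price log N / η, meet η ≥ a₁q²/(a²p), which leaves
  -- a²pq = Z.
  have e1 : logN / η * (u + 1) ≤ 1 / a₁ * (Z * (1 + l)) := by
    have h1 : logN ≤ 1 + l := by linarith
    have h2 : 0 < a₁ * (q ^ 2 / (a ^ 2 * p)) := by positivity
    calc logN / η * (u + 1) ≤ (1 + l) / (a₁ * (q ^ 2 / (a ^ 2 * p))) * (u + 1) := by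
          refine mul_le_mul_of_nonneg_right ?_ (by linarith)
          exact div_le_div₀ (by linarith) h1 h2 hη
      _ = _ := by rw [← huq, hZ]; field_simp
  rw [← hρ] at hτ
  rw [← hρ, ← hZ]
  have s1 : Z ≤ Z * (1 + l) := le_mul_of_one_le_right (by linarith) (by linarith)
  have e2 : (2 * C * H + c₃ * C ^ 2) * (c₁ * Z + 1) ≤
      (2 * C + c₃ * C ^ 2) * (c₁ + 1) * (Z * (1 + l) + Z * H) := by
    have h1 : c₁ * Z + 1 ≤ (c₁ + 1) * Z := by linarith
    have h2 : 2 * C * H + c₃ * C ^ 2 ≤ (2 * C + c₃ * C ^ 2) * (1 + l + H) := by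
      have : 0 ≤ 2 * C * (1 + l) + c₃ * C ^ 2 * (l + H) := by positivity
      linarith
    calc _ ≤ (2 * C + c₃ * C ^ 2) * (1 + l + H) * ((c₁ + 1) * Z) := by gcongr
      _ = _ := by ring
  have e3 : 2 * C * τ * u ≤ 2 * C * c₂ * (Z * (1 + l)) := by
    calc 2 * C * τ * u ≤ 2 * C * (c₂ * ρ) * u := by gcongr
      _ = 2 * C * c₂ * (ρ * u) := by ring
      _ ≤ 2 * C * c₂ * (Z * (1 + l)) := by
          have := hρu.trans s1
          gcongr
  have e4 : (C * τ * d + c₃ * C ^ 2) * (2 * X * e) ≤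
      (C * c₂ * d + c₃ * C ^ 2) * (2 * e) * (ρ * X) := by
    have h1 : C * τ * d + c₃ * C ^ 2 ≤ (C * c₂ * d + c₃ * C ^ 2) * ρ := by
      have h2 : C * τ * d ≤ C * (c₂ * ρ) * d := by gcongr
      have h3 : c₃ * C ^ 2 ≤ c₃ * C ^ 2 * ρ := le_mul_of_one_le_right hcC hρ1
      linarith
    calc _ ≤ (C * c₂ * d + c₃ * C ^ 2) * ρ * (2 * X * e) := by gcongr
      _ = _ := by ring
  have k1 : 0 ≤ 1 / a₁ := by positivity
  have k2 : 0 ≤ (2 * C + c₃ * C ^ 2) * (c₁ + 1) := by positivity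
  have k3 : 0 ≤ 2 * C * c₂ := by positivity
  have k4 : 0 ≤ (C * c₂ * d + c₃ * C ^ 2) * (2 * e) := by positivity
  have s2 : 0 ≤ Z * H := by positivity
  have s3 : 0 ≤ ρ * X := by positivity
  generalize 1 / a₁ = K₁ at *
  generalize (2 * C + c₃ * C ^ 2) * (c₁ + 1) = K₂ at *
  generalize (C * c₂ * d + c₃ * C ^ 2) * (2 * e) = K₄ at *
  generalize 2 * C * c₂ = K₃ at *
  have s0 : 0 ≤ Z * (1 + l) := by linarith
  generalize Z * (1 + l) = S₁ at *
  generalize Z * H = S₂ at *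
  generalize ρ * X = S₃ at *
  have f1 : K₁ * S₁ ≤ K₁ * (S₁ + S₂ + S₃) := mul_le_mul_of_nonneg_left (by linarith) k1
  have f2 : K₂ * (S₁ + S₂) ≤ K₂ * (S₁ + S₂ + S₃) := mul_le_mul_of_nonneg_left (by linarith) k2
  have f3 : K₃ * S₁ ≤ K₃ * (S₁ + S₂ + S₃) := mul_le_mul_of_nonneg_left (by linarith) k3
  have f4 : K₄ * S₃ ≤ K₄ * (S₁ + S₂ + S₃) := mul_le_mul_of_nonneg_left (by linarith) k4
  linarith

/-! ### The regret in terms of the scales -/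

lemma rpow_third_pow_three {x : ℝ} (hx : 0 ≤ x) : (x ^ (1 / 3 : ℝ)) ^ 3 = x := by
  rw [← Real.rpow_natCast, ← Real.rpow_mul hx]; norm_num

lemma rpow_two_thirds {x : ℝ} (hx : 0 ≤ x) : x ^ (2 / 3 : ℝ) = (x ^ (1 / 3 : ℝ)) ^ 2 := by
  rw [← Real.rpow_natCast, ← Real.rpow_mul hx]; norm_num

lemma rpow_neg_third {x : ℝ} (hx : 0 ≤ x) : x ^ (-(1 / 3) : ℝ) = (x ^ (1 / 3 : ℝ))⁻¹ :=
  Real.rpow_neg hx _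

section Scales

variable {n m g N u : ℕ} {D : Constants} {P : Plant n m g N} {A : AlgInput N} {z : ℝ} {i : Fin N}

lemma Admissible.one_le_N (_h : Admissible D P A z u i) : (1 : ℝ) ≤ N := by
  exact_mod_cast (Nat.one_le_iff_ne_zero.2 fun h0 => by subst h0; exact i.elim0)

lemma Admissible.pool_le (h : Admissible D P A z u i) : (N : ℝ) * (u + 1) ≤ A.T :=
  (le_max_right _ _).trans h.horizon

lemma Admissible.one_le_pool (h : Admissible D P A z u i) : (1 : ℝ) ≤ N * (u + 1) := by
  have h1 := h.one_le_N
  have h2 : (0 : ℝ) ≤ u := Nat.cast_nonneg u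
  nlinarith

/-- As τ_1 ≥ τ_0, the batch-ratio condition bounds β(τ_0)² itself by 1/(2√2). -/
lemma Admissible.beta_le (hD : D.Valid) (h : Admissible D P A z u i) :
    D.β (A.τ 0) ^ 2 ≤ 1 / 2 := by
  have hM := h.one_le_pool
  have h0 : (0 : ℝ) < A.τ 0 := by exact_mod_cast h.batch_pos
  have h1 : A.τ 0 ≤ A.τ 1 := by
    rw [h.batch]
    exact polyBatch_mono (by linarith) hD.ν (Nat.zero_le 1)
  have h2 : 1 ≤ (A.τ 1 : ℝ) / A.τ 0 := by
    rw [one_le_div h0]; exact_mod_cast h1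
  have h3 : 1 / (2 * √2) ≤ (1 : ℝ) / 2 := by
    refine one_div_le_one_div_of_le (by norm_num) ?_
    have : (1 : ℝ) ≤ √2 := by rw [Real.one_le_sqrt]; norm_num
    linarith
  nlinarith [h.batch_ratio, sq_nonneg (D.β (A.τ 0))]

set_option maxHeartbeats 1000000 in
/-- The regret bound, with `a = T^{1/3}`, `p = N^{1/3}`, `q = (|𝒰| + 1)^{1/3}`. -/
theorem exists_regret_le (hD : D.Valid) : ∃ c K κ : ℝ, 1 ≤ c ∧ 0 ≤ K ∧
    ∀ (n m g N u : ℕ) (P : Plant n m g N) (A : AlgInput N) (z : ℝ) (i : Fin N),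
      Admissible D P A z u i → ∀ a p q : ℝ, a = (A.T : ℝ) ^ (1 / 3 : ℝ) →
        p = (N : ℝ) ^ (1 / 3 : ℝ) → q = (u + 1 : ℝ) ^ (1 / 3 : ℝ) →
        regret D P A i ≤ K * (a ^ 2 * (p * q) * (1 + Real.log A.T)
          + a ^ 2 * (p * q) * cumDecay D.β ⌊c * (a / (p * q))⌋₊
          + a / (p * q) * Real.exp (κ * u)) := by
  obtain ⟨ag, hag1, hag⟩ := exists_growth_const hD
  obtain ⟨C, hC1, hC⟩ := exists_cost_const hD
  have hν := hD.ν
  have ha1 := hD.a1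
  have hx0 := hD.x0norm
  -- `c₀` is the growth constant of the batch lengths from below; `c₁` counts unbroken batches in
  -- units of Z, `c₂` bounds the longest batch in units of ρ, and `c₃` bounds η_0 N τ².
  obtain ⟨c₀, hc₀⟩ : ∃ c, c = min 1 (D.ν / 2) := ⟨_, rfl⟩
  have hc₀0 : 0 < c₀ := by rw [hc₀]; exact lt_min one_pos (by positivity)
  have hc₀1 : c₀ ≤ 1 := by rw [hc₀]; exact min_le_left _ _
  have hc₀ν : c₀ ≤ D.ν / 2 := by rw [hc₀]; exact min_le_right _ _
  obtain ⟨c₁, hc₁⟩ : ∃ c, c = 9 / (4 * c₀ ^ 2) := ⟨_, rfl⟩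
  have hc₁0 : 0 ≤ c₁ := by rw [hc₁]; positivity
  obtain ⟨c₂, hc₂⟩ : ∃ c, c = 2 + D.ν * (c₁ + 1) + |D.ζ| := ⟨_, rfl⟩
  have hc₂1 : 1 ≤ c₂ := by
    have h1 : 0 ≤ D.ν * (c₁ + 1) := by positivity
    linarith [abs_nonneg D.ζ]
  obtain ⟨c₃, hc₃⟩ : ∃ c, c = |D.a2| * c₂ ^ 2 := ⟨_, rfl⟩
  have hc₃0 : 0 ≤ c₃ := by rw [hc₃]; positivity
  have hAg : (1 : ℝ) ≤ 8 * ag ^ 4 + 2 := by nlinarith [sq_nonneg (ag ^ 2)]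
  refine ⟨c₂, 1 / D.a1 + (2 * C + c₃ * C ^ 2) * (c₁ + 1 + 1) + 2 * C * c₂
    + (C * c₂ * (2 / D.x0norm ^ 4 + 3) + c₃ * C ^ 2) * (2 * (D.x0norm ^ 4 + 1)),
    Real.log (8 * ag ^ 4 + 2), hc₂1, by positivity, ?_⟩
  intro n m g N u P A z i h a p q ha hp hq
  have hN := h.one_le_N
  have hM := h.one_le_pool
  have hMT := h.pool_le
  have hu0 : (0 : ℝ) ≤ u := Nat.cast_nonneg u
  have hT1 : (1 : ℝ) ≤ A.T := hM.trans hMT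
  have ha3 : a ^ 3 = A.T := by rw [ha]; exact rpow_third_pow_three (by linarith)
  have hp3 : p ^ 3 = N := by rw [hp]; exact rpow_third_pow_three (by linarith)
  have hq3 : q ^ 3 = u + 1 := by rw [hq]; exact rpow_third_pow_three (by linarith)
  have ha0 : 1 ≤ a := by rw [ha]; exact Real.one_le_rpow hT1 (by norm_num)
  have hp0 : 1 ≤ p := by rw [hp]; exact Real.one_le_rpow hN (by norm_num)
  have hq0 : 1 ≤ q := by rw [hq]; exact Real.one_le_rpow (by linarith) (by norm_num)
  have hpq : 1 ≤ p * q := one_le_mul_of_one_le_of_one_le hp0 hq0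
  have hpq3 : (p * q) ^ 3 = N * (u + 1) := by rw [mul_pow, hp3, hq3]
  have hpqa : p * q ≤ a := by
    refine le_of_pow_le_pow_left₀ (n := 3) (by norm_num) (by linarith) ?_
    rw [hpq3, ha3]; exact hMT
  have hη1 : D.a1 * (q ^ 2 / (a ^ 2 * p)) ≤ A.η₀ := by
    have := h.rate_lower
    rwa [rpow_two_thirds (by linarith), rpow_two_thirds (by linarith), ← ha, ← hp, ← hq] at this
  have hη2 : A.η₀ ≤ D.a2 * (q ^ 2 / (a ^ 2 * p)) := by
    have := h.rate_upper
    rwa [rpow_two_thirds (by linarith), rpow_two_thirds (by linarith), ← ha, ← hp, ← hq] at this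
  have hη0 : 0 < A.η₀ := lt_of_lt_of_le (by positivity) hη1
  obtain ⟨ρ, hρ⟩ : ∃ ρ, ρ = a / (p * q) := ⟨_, rfl⟩
  have hρ1 : 1 ≤ ρ := by rw [hρ, one_le_div (by linarith)]; exact hpqa
  obtain ⟨Z, hZ⟩ : ∃ Z, Z = a ^ 2 * (p * q) := ⟨_, rfl⟩
  have hZ3 : Z ^ 3 = (A.T : ℝ) ^ 2 * (N * (u + 1)) := by
    rw [hZ, mul_pow, hpq3, ← ha3]; ring
  have hZ1 : 1 ≤ Z := by
    rw [hZ]; exact one_le_mul_of_one_le_of_one_le (one_le_pow₀ ha0) hpq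
  have huM : (u : ℝ) ≤ (p * q) ^ 3 := by
    rw [hpq3]
    have := mul_le_mul_of_nonneg_right hN (by linarith : (0 : ℝ) ≤ u + 1)
    linarith
  have huZ : (u : ℝ) ≤ Z := by
    refine huM.trans ?_
    rw [hZ, pow_succ]
    gcongr
  have hZM : Z / (N * (u + 1)) = ρ ^ 2 := by
    rw [hZ, hρ, ← hpq3]; field_simp
  have hδpos : 0 < 1 - D.β (A.τ 0) := by
    have h1 := h.beta_le hD
    have h2 := hD.β.nonneg (A.τ 0)
    nlinarith only [h1, h2]
  have hoff : D.γ * D.wmax ≤ D.δ * (1 - D.β (A.τ 0)) := by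
    have := h.offset
    rwa [div_le_iff₀ hδpos] at this
  have hδ0 : 0 ≤ D.δ := by
    refine le_trans ?_ h.offset
    have := hD.γ
    have := hD.wmax
    positivity
  obtain ⟨τm, hτm⟩ : ∃ τm, τm = ⌊c₂ * ρ⌋₊ := ⟨_, rfl⟩
  have hτmρ : (τm : ℝ) ≤ c₂ * ρ := by rw [hτm]; exact Nat.floor_le (by positivity)
  have hlen : ∀ b : ℕ, (b : ℝ) ≤ (c₁ + 1) * Z → A.τ b ≤ τm := by
    intro b hb
    rw [hτm, h.batch, hc₂]
    exact polyBatch_le_floor (by linarith) hν (by linarith) h.z_le hZM hρ1 hb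
  -- The scale of η_0 balances exactly: q²/(a²p) · p³ · (a/(pq))² = 1.
  have hηN : A.η₀ * N * τm ^ 2 ≤ c₃ := by
    have h1 : (τm : ℝ) ^ 2 ≤ (c₂ * ρ) ^ 2 := by gcongr
    have h2 : A.η₀ ≤ |D.a2| * (q ^ 2 / (a ^ 2 * p)) :=
      hη2.trans (mul_le_mul_of_nonneg_right (le_abs_self _) (by positivity))
    calc A.η₀ * N * τm ^ 2 ≤ |D.a2| * (q ^ 2 / (a ^ 2 * p)) * N * (c₂ * ρ) ^ 2 := by gcongr
      _ = c₃ := by rw [hc₃, hρ, ← hp3]; field_simp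
  have hH0 := cumDecay_nonneg hD.β τm
  -- In `Bm`, `c₁ * Z` counts the unbroken batches and the extra `Z` dominates the at most `u`
  -- broken ones. The 3 in `EV` is 2 + 1, meeting both conditions `EV` and `EV'`.
  let G : Budget :=
    { u := u, a := ag, L := Real.log N / A.η₀, EB := 2 * C * cumDecay D.β τm + c₃ * C ^ 2,
      Eu := 2 * C * τm, EV := C * τm * (2 / D.x0norm ^ 4 + 3) + c₃ * C ^ 2,
      Bm := (c₁ + 1) * Z }
  have hηC : A.η₀ * N * C ^ 2 * τm ^ 2 ≤ c₃ * C ^ 2 := by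
    have := mul_le_mul_of_nonneg_right hηN (sq_nonneg C)
    linarith
  have hx4 : 0 ≤ C * τm * (2 / D.x0norm ^ 4) := by positivity
  have hCτ : 0 ≤ C * τm := by positivity
  have hcC : 0 ≤ c₃ * C ^ 2 := by positivity
  have hG : G.Sound D P A i C τm :=
    { valid := hD
      regular := h.regular
      pick := h.pick
      mono := by rw [h.batch]; exact polyBatch_mono (by linarith) hν
      pos := h.batch_pos
      contr := by
        have h1 := h.beta_le hD
        nlinarith only [h1, sq_nonneg (D.β (A.τ 0))]
      offset := hoff
      offset_nonneg := hδ0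
      rate_pos := hη0
      best := h.best_mem
      card := h.card_destabilizing
      batches := fun n hn => by
        rw [h.batch] at hn
        have h0 := h.batch_pos
        rw [h.batch] at h0
        have h1 := card_batches_le hM h.z_pos hc₀0 hc₀1 hc₀ν h0 (by linarith) hZ3
          (n := n) (by exact_mod_cast hn)
        rw [← hc₁] at h1
        change (n : ℝ) + u ≤ (c₁ + 1) * Z
        linarith
      lengths := hlen
      growth := fun σ k h1 => hag n m g N P A σ k h.regular hδ0 h1
      one_le_a := hag1
      one_le_C := hC1
      cost := fun σ k => (hC n m g N P A σ h.regular hδ0).1 k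
      compare := fun σ => (hC n m g N P A σ h.regular hδ0).2 i h.best_mem
      L := rfl
      EB := by change _ ≤ 2 * C * cumDecay D.β τm + c₃ * C ^ 2; linarith
      Eu := le_rfl
      EV := by change _ ≤ C * τm * (2 / D.x0norm ^ 4 + 3) + c₃ * C ^ 2; linarith
      EV' := by change _ ≤ C * τm * (2 / D.x0norm ^ 4 + 3) + c₃ * C ^ 2; linarith }
  refine hG.regret_le.trans ?_
  change Real.log N / A.η₀ * (u + 1)
      + (2 * C * cumDecay D.β τm + c₃ * C ^ 2) * ((c₁ + 1) * Z + 1) + 2 * C * τm * u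
      + (C * τm * (2 / D.x0norm ^ 4 + 3) + c₃ * C ^ 2)
        * (2 * (8 * ag ^ 4 + 2) ^ u * (D.x0norm ^ 4 + 1)) ≤ _
  have hlogT : 0 ≤ Real.log A.T := Real.log_nonneg hT1
  have hlogN : Real.log N ≤ Real.log A.T := by
    refine Real.log_le_log (by linarith) (le_trans ?_ hMT)
    exact le_mul_of_one_le_right (by linarith) (by linarith)
  have hexp : (8 * ag ^ 4 + 2) ^ u = Real.exp (Real.log (8 * ag ^ 4 + 2) * u) := by
    rw [mul_comm (Real.log _), Real.exp_nat_mul, Real.exp_log (by linarith)]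
  rw [hexp, hZ, ← hρ, ← hτm, hρ]
  exact overhead_total_le ha0 hp0 hq0 hpqa hu0 hq3 ha1 hη1 hlogT hlogN hH0 (Real.exp_pos _).le
    (hτmρ.trans_eq (by rw [hρ])) (by linarith) (by linarith) (by linarith) hc₃0 (by positivity)
    (by positivity)

end Scales

/-! ### From the scales to the stated rates -/

lemma mul_exp_le {ρ X : ℝ} (hρ : 1 ≤ ρ) (hX : 0 ≤ X) : ρ * X ≤ ρ ^ 2 + ρ⁻¹ * X ^ 3 := by
  have hρ0 : 0 < ρ := by linarith
  have h3 : 0 ≤ ρ⁻¹ * X ^ 3 := by positivity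
  -- If X ≤ ρ the square dominates; otherwise ρ² ≤ X². The exponential thus trades a growing factor
  -- ρ for a vanishing 1/ρ, at the price of tripling its exponent.
  rcases le_total X ρ with h | h
  · nlinarith
  · have h1 : ρ ^ 2 * X ≤ X ^ 3 := by
      have : ρ ^ 2 ≤ X ^ 2 := by gcongr
      nlinarith
    have h2 : ρ * X ≤ ρ⁻¹ * X ^ 3 := by
      rw [inv_mul_eq_div, le_div_iff₀ hρ0]
      linarith
    nlinarith [sq_nonneg ρ]

lemma exp_pow_three (κ u : ℝ) : Real.exp (κ * u) ^ 3 = Real.exp (3 * κ * u) := by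
  rw [← Real.exp_nat_mul]; push_cast; ring_nf

/-- The quotient is at most c times the Cesàro mean of β over ⌊cx⌋ terms, and β → 0. -/
lemma tendsto_cumDecay_div {β : ℕ → ℝ} (hβ : IsDecay β) {c : ℝ} (hc : 0 < c) :
    Tendsto (fun x : ℝ => cumDecay β ⌊c * x⌋₊ / x) atTop (𝓝 0) := by
  have h1 : Tendsto (fun n : ℕ => (n⁻¹ : ℝ) * ∑ i ∈ Finset.range n, β i) atTop (𝓝 0) :=
    hβ.tendsto.cesaro
  have h2 : Tendsto (fun x : ℝ => ⌊c * x⌋₊) atTop atTop :=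
    tendsto_nat_floor_atTop.comp (tendsto_id.const_mul_atTop hc)
  have h3 := (h1.comp h2).const_mul c
  rw [mul_zero] at h3
  refine squeeze_zero' ?_ ?_ h3
  · filter_upwards [eventually_gt_atTop 0] with x hx
    exact div_nonneg (cumDecay_nonneg hβ _) hx.le
  · filter_upwards [eventually_gt_atTop 0, h2.eventually_ge_atTop 1] with x hx hfl
    have h4 : (⌊c * x⌋₊ : ℝ) ≤ c * x := Nat.floor_le (by positivity)
    have h5 : (0 : ℝ) < ⌊c * x⌋₊ := by exact_mod_cast hfl
    have h6 : 0 ≤ cumDecay β ⌊c * x⌋₊ := cumDecay_nonneg hβ _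
    change _ ≤ c * ((⌊c * x⌋₊ : ℝ)⁻¹ * cumDecay β ⌊c * x⌋₊)
    rw [inv_mul_eq_div, ← mul_div_assoc, div_le_div_iff₀ hx h5]
    nlinarith

lemma cumDecay_le_log {β : ℕ → ℝ} {h : ℝ}
    (hh : ∀ t : ℕ, 1 ≤ t → cumDecay β t ≤ h * ∑ j ∈ Finset.Icc 1 t, 1 / (j : ℝ))
    {c ρ T : ℝ} (hc : 1 ≤ c) (hρ : 1 ≤ ρ) (hρT : ρ ≤ T) :
    cumDecay β ⌊c * ρ⌋₊ ≤ |h| * (1 + Real.log c) * (1 + Real.log T) := by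
  have hcρ : 1 ≤ c * ρ := one_le_mul_of_one_le_of_one_le hc hρ
  have h1 : 1 ≤ ⌊c * ρ⌋₊ := Nat.le_floor (by simpa using hcρ)
  have h2 : ∑ j ∈ Finset.Icc 1 ⌊c * ρ⌋₊, 1 / (j : ℝ) ≤ 1 + Real.log ⌊c * ρ⌋₊ := by
    have h3 := harmonic_le_one_add_log ⌊c * ρ⌋₊
    rw [harmonic_eq_sum_Icc] at h3
    push_cast at h3
    simpa only [one_div] using h3
  have h4 : Real.log ⌊c * ρ⌋₊ ≤ Real.log c + Real.log T := by
    have h5 : (0 : ℝ) < ⌊c * ρ⌋₊ := by exact_mod_cast h1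
    rw [← Real.log_mul (by linarith) (by linarith)]
    refine Real.log_le_log h5 ((Nat.floor_le (by linarith)).trans ?_)
    gcongr
  have h6 : 0 ≤ ∑ j ∈ Finset.Icc 1 ⌊c * ρ⌋₊, 1 / (j : ℝ) :=
    Finset.sum_nonneg fun j _ => by positivity
  have hlc := Real.log_nonneg hc
  have hlT := Real.log_nonneg (hρ.trans hρT)
  calc cumDecay β ⌊c * ρ⌋₊ ≤ h * ∑ j ∈ Finset.Icc 1 ⌊c * ρ⌋₊, 1 / (j : ℝ) := hh _ h1
    _ ≤ |h| * ∑ j ∈ Finset.Icc 1 ⌊c * ρ⌋₊, 1 / (j : ℝ) :=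
        mul_le_mul_of_nonneg_right (le_abs_self h) h6
    _ ≤ |h| * ((1 + Real.log c) * (1 + Real.log T)) := by
        refine mul_le_mul_of_nonneg_left ?_ (abs_nonneg h)
        nlinarith [mul_nonneg hlc hlT]
    _ = _ := by ring

/-- The explicit form of the sublinear bound. -/
theorem exists_sublinear_bound (D : Constants) (hD : D.Valid) :
    ∃ (C κ : ℝ) (ε₁ ε₂ : ℝ → ℝ), Tendsto ε₁ atTop (𝓝 0) ∧ Tendsto ε₂ atTop (𝓝 0) ∧
      ∀ (n m g N u : ℕ) (P : Plant n m g N) (A : AlgInput N) (z : ℝ) (i : Fin N),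
        Admissible D P A z u i →
        regret D P A i ≤
          C * (A.T : ℝ) ^ (2 / 3 : ℝ) * (1 + Real.log A.T) ^ 1
              * (N : ℝ) ^ (1 / 3 : ℝ) * (u + 1 : ℝ) ^ (1 / 3 : ℝ)
            + ε₁ (A.T / (N * (u + 1))) * Real.exp (κ * u)
            + ε₂ (A.T / (N * (u + 1))) * A.T := by
  obtain ⟨c, K, κ, hc, hK, hreg⟩ := exists_regret_le hD
  have hthird : Tendsto (fun x : ℝ => x ^ (1 / 3 : ℝ)) atTop atTop :=
    tendsto_rpow_atTop (by norm_num)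
  -- Because Zρ = T, the term Z H(cρ) is (H(cρ)/ρ) T, which is `ε₂`. `mul_exp_le` splits the
  -- exponential term: its ρ⁻¹ part gives `ε₁` and the factor 3, and its ρ² part is absorbed in Z(1
  -- + log T), doubling `K`.
  refine ⟨2 * K, 3 * κ, fun x => K * (x ^ (1 / 3 : ℝ))⁻¹,
    fun x => K * (cumDecay D.β ⌊c * x ^ (1 / 3 : ℝ)⌋₊ / x ^ (1 / 3 : ℝ)), ?_, ?_, ?_⟩
  · simpa using (tendsto_inv_atTop_zero.comp hthird).const_mul K
  · simpa using ((tendsto_cumDecay_div hD.β (by linarith : 0 < c)).comp hthird).const_mul K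
  intro n m g N u P A z i h
  have hN := h.one_le_N
  have hM := h.one_le_pool
  have hT1 : (1 : ℝ) ≤ A.T := hM.trans h.pool_le
  have hu0 : (0 : ℝ) ≤ u := Nat.cast_nonneg u
  have hr := hreg n m g N u P A z i h _ _ _ rfl rfl rfl
  have hρ : ((A.T : ℝ) / (N * (u + 1))) ^ (1 / 3 : ℝ) =
      (A.T : ℝ) ^ (1 / 3 : ℝ) / ((N : ℝ) ^ (1 / 3 : ℝ) * (u + 1 : ℝ) ^ (1 / 3 : ℝ)) := by
    rw [Real.div_rpow (by linarith) (by linarith), Real.mul_rpow (by linarith) (by linarith)]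
  have hρ1 : 1 ≤ ((A.T : ℝ) / (N * (u + 1))) ^ (1 / 3 : ℝ) :=
    Real.one_le_rpow ((one_le_div (by linarith)).2 h.pool_le) (by norm_num)
  have ha0 : 1 ≤ (A.T : ℝ) ^ (1 / 3 : ℝ) := Real.one_le_rpow hT1 (by norm_num)
  have hp0 : 1 ≤ (N : ℝ) ^ (1 / 3 : ℝ) := Real.one_le_rpow hN (by norm_num)
  have hq0 : 1 ≤ (u + 1 : ℝ) ^ (1 / 3 : ℝ) := Real.one_le_rpow (by linarith) (by norm_num)
  have ha3 := rpow_third_pow_three (by linarith : (0 : ℝ) ≤ A.T)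
  simp only [hρ, pow_one, rpow_two_thirds (by linarith : (0 : ℝ) ≤ A.T)]
  rw [hρ] at hρ1
  have hlog := Real.log_nonneg hT1
  generalize Real.log A.T = l at *
  generalize (A.T : ℝ) ^ (1 / 3 : ℝ) = a at *
  generalize (N : ℝ) ^ (1 / 3 : ℝ) = p at *
  generalize (u + 1 : ℝ) ^ (1 / 3 : ℝ) = q at *
  have hpq : 1 ≤ p * q := one_le_mul_of_one_le_of_one_le hp0 hq0
  have hX := mul_exp_le hρ1 (Real.exp_pos (κ * u)).le
  rw [exp_pow_three] at hX
  have hZH : cumDecay D.β ⌊c * (a / (p * q))⌋₊ / (a / (p * q)) * A.T =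
      a ^ 2 * (p * q) * cumDecay D.β ⌊c * (a / (p * q))⌋₊ := by
    rw [← ha3]; field_simp
  have hsq : (a / (p * q)) ^ 2 ≤ a ^ 2 * (p * q) * (1 + l) := by
    calc (a / (p * q)) ^ 2 ≤ a ^ 2 := by
          have : a / (p * q) ≤ a := div_le_self (by linarith) hpq
          gcongr
      _ ≤ a ^ 2 * ((p * q) * (1 + l)) := le_mul_of_one_le_right (by positivity)
          (one_le_mul_of_one_le_of_one_le hpq (by linarith))
      _ = _ := by ring
  have h1 := mul_le_mul_of_nonneg_left (hX.trans (add_le_add_left hsq _)) hK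
  rw [mul_assoc K (_ / _), hZH]
  linarith

/-- The rate when the cumulative decay is at most of harmonic order. -/
theorem exists_harmonic_bound (D : Constants) (hD : D.Valid)
    (hH : ∃ h : ℝ, ∀ t : ℕ, 1 ≤ t →
      cumDecay D.β t ≤ h * ∑ j ∈ Finset.Icc 1 t, 1 / (j : ℝ)) :
    ∃ C κ : ℝ,
      ∀ (n m g N u : ℕ) (P : Plant n m g N) (A : AlgInput N) (z : ℝ) (i : Fin N),
        Admissible D P A z u i →
        regret D P A i ≤
          (C * (A.T : ℝ) ^ (2 / 3 : ℝ) * (1 + Real.log A.T) ^ 1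
            + C * (A.T : ℝ) ^ (-(1 / 3) : ℝ) * (1 + Real.log A.T) ^ 1 * Real.exp (κ * u))
            * (N : ℝ) ^ (1 / 3 : ℝ) * (u + 1 : ℝ) ^ (1 / 3 : ℝ) := by
  obtain ⟨h', hh⟩ := hH
  obtain ⟨c, K, κ, hc, hK, hreg⟩ := exists_regret_le hD
  refine ⟨K * (2 + |h'| * (1 + Real.log c)), 3 * κ, ?_⟩
  intro n m g N u P A z i h
  have hN := h.one_le_N
  have hT1 : (1 : ℝ) ≤ A.T := h.one_le_pool.trans h.pool_le
  have hu0 : (0 : ℝ) ≤ u := Nat.cast_nonneg u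
  have hr := hreg n m g N u P A z i h _ _ _ rfl rfl rfl
  have hρ1 : 1 ≤ (A.T : ℝ) ^ (1 / 3 : ℝ) /
      ((N : ℝ) ^ (1 / 3 : ℝ) * (u + 1 : ℝ) ^ (1 / 3 : ℝ)) := by
    rw [← Real.mul_rpow (by linarith) (by linarith), ← Real.div_rpow (by linarith) (by positivity)]
    exact Real.one_le_rpow ((one_le_div (by linarith [h.one_le_pool])).2 h.pool_le) (by norm_num)
  have ha0 : 1 ≤ (A.T : ℝ) ^ (1 / 3 : ℝ) := Real.one_le_rpow hT1 (by norm_num)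
  have haT : (A.T : ℝ) ^ (1 / 3 : ℝ) ≤ A.T := by
    simpa using Real.rpow_le_rpow_of_exponent_le hT1 (by norm_num : (1 / 3 : ℝ) ≤ 1)
  have hp0 : 1 ≤ (N : ℝ) ^ (1 / 3 : ℝ) := Real.one_le_rpow hN (by norm_num)
  have hq0 : 1 ≤ (u + 1 : ℝ) ^ (1 / 3 : ℝ) := Real.one_le_rpow (by linarith) (by norm_num)
  rw [rpow_two_thirds (by linarith : (0 : ℝ) ≤ A.T), rpow_neg_third (by linarith : (0 : ℝ) ≤ A.T)]
  simp only [pow_one]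
  have hlog := Real.log_nonneg hT1
  have hlogc := Real.log_nonneg hc
  generalize (A.T : ℝ) ^ (1 / 3 : ℝ) = a at *
  generalize (N : ℝ) ^ (1 / 3 : ℝ) = p at *
  generalize (u + 1 : ℝ) ^ (1 / 3 : ℝ) = q at *
  have hpq : 1 ≤ p * q := one_le_mul_of_one_le_of_one_le hp0 hq0
  have hρa : a / (p * q) ≤ a := div_le_self (by linarith) hpq
  have hHl := cumDecay_le_log hh hc hρ1 (hρa.trans haT)
  -- The splitting uses a = T^{1/3} instead of ρ, since the target factor T^{-1/3} does not involve
  -- M.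
  have hX := mul_exp_le ha0 (Real.exp_pos (κ * u)).le
  rw [exp_pow_three] at hX
  have hh0 : 0 ≤ |h'| * (1 + Real.log c) := by positivity
  generalize |h'| * (1 + Real.log c) = k at *
  obtain ⟨l, hl⟩ : ∃ l, l = 1 + Real.log A.T := ⟨_, rfl⟩
  have hl1 : 1 ≤ l := by linarith
  rw [← hl] at hr hHl ⊢
  generalize cumDecay D.β ⌊c * (a / (p * q))⌋₊ = H at *
  have hE : 0 < Real.exp (κ * u) := Real.exp_pos _
  have hE' : 0 < Real.exp (3 * κ * u) := Real.exp_pos _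
  generalize Real.exp (κ * u) = X at *
  generalize Real.exp (3 * κ * u) = Y at *
  have hlpq : 1 ≤ l * (p * q) := one_le_mul_of_one_le_of_one_le hl1 hpq
  have hinv : 0 < a⁻¹ := by positivity
  have s1 : a / (p * q) * X ≤ (a ^ 2 + a⁻¹ * Y) * (l * (p * q)) := by
    calc a / (p * q) * X ≤ a * X := by gcongr
      _ ≤ a ^ 2 + a⁻¹ * Y := hX
      _ ≤ _ := le_mul_of_one_le_right (by positivity) hlpq
  have s2 : a ^ 2 * (p * q) * H ≤ k * a ^ 2 * l * (p * q) := by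
    calc a ^ 2 * (p * q) * H ≤ a ^ 2 * (p * q) * (k * l) := by gcongr
      _ = _ := by ring
  have s3 : 0 ≤ (1 + k) * (a⁻¹ * l * Y * (p * q)) := by positivity
  refine hr.trans ?_
  calc K * (a ^ 2 * (p * q) * l + a ^ 2 * (p * q) * H + a / (p * q) * X)
      ≤ K * ((2 + k) * a ^ 2 * l * (p * q) + (2 + k) * (a⁻¹ * l * Y * (p * q))) := by
        refine mul_le_mul_of_nonneg_left ?_ hK
        linarith
    _ = _ := by ring

lemma tendsto_two_thirds_log_div :
    Tendsto (fun x : ℝ => x ^ (2 / 3 : ℝ) * (1 + Real.log x) / x) atTop (𝓝 0) := by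
  have h1 : Tendsto (fun x : ℝ => x ^ (-(1 / 3) : ℝ)) atTop (𝓝 0) :=
    tendsto_rpow_neg_atTop (by norm_num)
  have h2 : Tendsto (fun x : ℝ => Real.log x / x ^ (1 / 3 : ℝ)) atTop (𝓝 0) :=
    (isLittleO_log_rpow_atTop (by norm_num : (0 : ℝ) < 1 / 3)).tendsto_div_nhds_zero
  have h3 := h1.add h2
  rw [add_zero] at h3
  refine h3.congr' ?_
  filter_upwards [eventually_gt_atTop 0] with x hx
  rw [rpow_neg_third hx.le, rpow_two_thirds hx.le]
  have h4 := rpow_third_pow_three hx.le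
  have h5 : 0 < x ^ (1 / 3 : ℝ) := Real.rpow_pos_of_pos hx _
  generalize x ^ (1 / 3 : ℝ) = a at *
  rw [← h4]
  field_simp

/-- For a fixed pool size and number of destabilizing controllers the regret is sublinear. -/
theorem exists_regret_le_mul (D : Constants) (hD : D.Valid) (N u : ℕ) (ε : ℝ) (hε : 0 < ε) :
    ∃ T₀ : ℕ, ∀ (n m g : ℕ) (P : Plant n m g N) (A : AlgInput N) (z : ℝ) (i : Fin N),
      Admissible D P A z u i → T₀ ≤ A.T → regret D P A i ≤ ε * A.T := by
  rcases Nat.eq_zero_or_pos N with rfl | hN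
  · exact ⟨0, fun n m g P A z i => i.elim0⟩
  obtain ⟨C, κ, ε₁, ε₂, h1, h2, h⟩ := exists_sublinear_bound D hD
  have hM : (0 : ℝ) < N * (u + 1) := by
    have : (0 : ℝ) < N := by exact_mod_cast hN
    positivity
  have hdiv : Tendsto (fun x : ℝ => x / (N * (u + 1))) atTop atTop :=
    tendsto_id.atTop_div_const hM
  have hinv : Tendsto (fun x : ℝ => x⁻¹) atTop (𝓝 0) := tendsto_inv_atTop_zero
  have hlim : Tendsto (fun x : ℝ =>
      C * (N : ℝ) ^ (1 / 3 : ℝ) * (u + 1 : ℝ) ^ (1 / 3 : ℝ)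
          * (x ^ (2 / 3 : ℝ) * (1 + Real.log x) / x)
        + ε₁ (x / (N * (u + 1))) * x⁻¹ * Real.exp (κ * u) + ε₂ (x / (N * (u + 1))))
      atTop (𝓝 0) := by
    simpa using ((tendsto_two_thirds_log_div.const_mul
      (C * (N : ℝ) ^ (1 / 3 : ℝ) * (u + 1 : ℝ) ^ (1 / 3 : ℝ))).add
        (((h1.comp hdiv).mul hinv).mul_const (Real.exp (κ * u)))).add (h2.comp hdiv)
  obtain ⟨x₀, hx₀⟩ := eventually_atTop.1 ((hlim.eventually_lt_const hε).and
    (eventually_gt_atTop 0))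
  refine ⟨⌈x₀⌉₊, fun n m g P A z i hA hT => ?_⟩
  obtain ⟨h3, h4⟩ := hx₀ A.T ((Nat.le_ceil x₀).trans (by exact_mod_cast hT))
  refine (h n m g N u P A z i hA).trans ?_
  have h5 := mul_le_mul_of_nonneg_right h3.le h4.le
  refine le_trans (le_of_eq ?_) h5
  field_simp

end DBAR

theorem mainTheorem4 (D : DBAR.Constants) (hD : D.Valid) :
    -- explicit form of the sublinear bound
    (∃ (C κ : ℝ) (p : ℕ) (ε₁ ε₂ : ℝ → ℝ), Tendsto ε₁ atTop (𝓝 0) ∧ Tendsto ε₂ atTop (𝓝 0) ∧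
      ∀ (n m g N u : ℕ) (P : DBAR.Plant n m g N) (A : DBAR.AlgInput N) (z : ℝ) (i : Fin N),
        DBAR.Admissible D P A z u i →
        DBAR.regret D P A i ≤
          C * (A.T : ℝ) ^ (2 / 3 : ℝ) * (1 + Real.log A.T) ^ p
              * (N : ℝ) ^ (1 / 3 : ℝ) * (u + 1 : ℝ) ^ (1 / 3 : ℝ)
            + ε₁ (A.T / (N * (u + 1))) * Real.exp (κ * u)
            + ε₂ (A.T / (N * (u + 1))) * A.T) ∧
    -- the regret is sublinear for every fixed pool size and number of destabilizing controllers
    (∀ (N u : ℕ) (ε : ℝ), 0 < ε → ∃ T₀ : ℕ,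
      ∀ (n m g : ℕ) (P : DBAR.Plant n m g N) (A : DBAR.AlgInput N) (z : ℝ) (i : Fin N),
        DBAR.Admissible D P A z u i → T₀ ≤ A.T → DBAR.regret D P A i ≤ ε * A.T) ∧
    -- the rate when the cumulative decay is at most of harmonic order
    ((∃ h : ℝ, ∀ t : ℕ, 1 ≤ t →
        DBAR.cumDecay D.β t ≤ h * ∑ j ∈ Finset.Icc 1 t, 1 / (j : ℝ)) →
      ∃ (C κ : ℝ) (p : ℕ),
        ∀ (n m g N u : ℕ) (P : DBAR.Plant n m g N) (A : DBAR.AlgInput N) (z : ℝ) (i : Fin N),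
          DBAR.Admissible D P A z u i →
          DBAR.regret D P A i ≤
            (C * (A.T : ℝ) ^ (2 / 3 : ℝ) * (1 + Real.log A.T) ^ p
              + C * (A.T : ℝ) ^ (-(1 / 3) : ℝ) * (1 + Real.log A.T) ^ p * Real.exp (κ * u))
              * (N : ℝ) ^ (1 / 3 : ℝ) * (u + 1 : ℝ) ^ (1 / 3 : ℝ)) := by
  refine ⟨?_, DBAR.exists_regret_le_mul D hD, fun hH => ?_⟩
  · obtain ⟨C, κ, ε₁, ε₂, h⟩ := DBAR.exists_sublinear_bound D hD
    exact ⟨C, κ, 1, ε₁, ε₂, h⟩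
  · obtain ⟨C, κ, h⟩ := DBAR.exists_harmonic_bound D hD hH
    exact ⟨C, κ, 1, h⟩
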